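/- **Setting.** Let $\mathcal D$ be a discrete distribution on $\{x\in\mathbb R^d:\|x\|_2\le 1\}\times\{\pm1\}$. For an integer $k\ge 0$ and a real $B\ge 1$, $\mathcal D$ is $(k,B)$-realizable if there are a set $\kappa\subseteq[d]$ with $|\kappa|\le k$ and $w\in\mathbb R^d$ with $\|w\|_2^2\le B^2$ such that, almost surely over $(x,y)\sim\mathcal D$: $y=1$ if $x(j)>0$ for some $j\in\kappa$, and $y\langle w,x\rangle\ge 1$ if $x(j)\le 0$ for all $j\in\kappa$. **GreedyRule.** On a sample $S=((x_i,y_i))_{i=1}^m$, a coordinate $j$ is a *rule* if $y_i=1$ whenever $x_i(j)>0$, and then it *covers* the examples with $x_i(j)>0$. Start with $\kappa=\emptyset$ and, as long as some rule covers more than $\frac{m}{100k(B+1)}$ of the examples not covered by $\kappa$, add such a rule to $\kappa$ (if $k=0$, nothing is added). Then choose $w$ that minimizes the hinge loss $\sum\max\{0,1-y_i\langle w,x_i\rangle\}$ over the examples not covered by $\kappa$, subject to $\|w\|_2^2\le B^2$. The returned classifier maps $x$ to $1$ if $x(j)>0$ for some $j\in\kappa$, and to the sign of $\langle w,x\rangle$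 otherwise (here and below the sign of $0$ is $-1$). The choices that are left open may be resolved arbitrarily (by a function of the sample). **BoostRule** with parameters $T,r$ is AdaBoost with $T$ rounds and GreedyRule as weak learner: in each round, $r$ examples are drawn independently from the current AdaBoost distribution on the $n$ training examples (weight of the $i$-th one proportional to $e^{-y_iF(x_i)}$, where $F$ is the current weighted vote, initially $0$), GreedyRule is run on them, and its hypothesis $h$, with weighted training error $e$, enters the vote with weight $\frac12\log\frac{1-e}{e}$. If $e=0$, $h$ is returned; if $e\ge\frac12$, the loop stops with the current vote. The output is the sign of the vote. **Theorem.** Write $M=kB\log(d+1)+B^2$. There are universal constants $C>0$ and $c\in\mathbb N$ such that: 1. For every $\delta\in(0,1)$ there are parameters $T,r$, depending on $d,k,B,\delta$ and the sample size $n$ only, such that for all $d,k$, $B\ge1$, $\epsilon\in(0,1)$ and all $$n\ \ge\ C\,\frac{M}{\epsilon}\,\log^c\!\Big(2+\frac{M}{\epsilon\delta}\Big)$$ we have $T,r\le n$, and for every $(k,B)$-realizable $\mathcal D$ as above, with probability at least $1-\delta$ over $n$ i.i.d. examples from $\mathcal D$ and the internal randomness, BoostRule with these parameters returns $h:\mathbb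 R^d\to\{\pm1\}$ with $\ell_{\mathrm{ramp}}(h,\mathcal D)\le\epsilon$, where $\ell_{\mathrm{ramp}}(h,\mathcal D)=\mathbb E_{(x,y)\sim\mathcal D}\max\{0,\min\{1,1-y\,h(x)\}\}$. (As $h$ is $\pm1$-valued, this is its misclassification error.) That is, BoostRule learns $(k,B)$-realizable distributions with sample complexity $\tilde O\big((kB+B^2)/\epsilon\big)$. 2. For every $\delta\in(0,1)$, $d,k$, $B\ge1$, every $(k,B)$-realizable $\mathcal D$ as above and every $m\ge C\,M\,\log^c\!\big(2+\frac{M}{\delta}\big)$, with probability at least $1-\delta$ over $m$ i.i.d. examples from $\mathcal D$, GreedyRule returns a classifier $h$ with $\Pr_{(x,y)\sim\mathcal D}(h(x)\ne y)\le\frac14$. -/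

import Mathlib

namespace RulesFirst

noncomputable section

/-- A labelled example `(x, y)` with `x ∈ ℝ^d` (Euclidean norm) and `y ∈ {1, -1}`. -/
abbrev LabelledExample (d : ℕ) : Type := EuclideanSpace ℝ (Fin d) × ℤˣ

/-- A classifier `ℝ^d → {1, -1}`. -/
abbrev Classifier (d : ℕ) : Type := EuclideanSpace ℝ (Fin d) → ℤˣ

/-- A label as a real number. -/
def labelVal (y : ℤˣ) : ℝ := ((y : ℤ) : ℝ)

/-- The label predicted by a real score. -/
def sgn (t : ℝ) : ℤˣ := if 0 < t then 1 else -1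

/-! ### Losses -/

/-- The hinge loss `max {0, 1 - ŷ y}`. -/
def hinge (s : ℝ) (y : ℤˣ) : ℝ := max 0 (1 - s * labelVal y)

/-- The ramp loss `max (0, min (1 - ŷ y, 1))`. -/
def ramp (s : ℝ) (y : ℤˣ) : ℝ := max 0 (min (1 - s * labelVal y) 1)

/-- The expected ramp loss of a real-valued predictor under the distribution `D`. -/
def rampLoss {d : ℕ} (D : PMF (LabelledExample d)) (f : EuclideanSpace ℝ (Fin d) → ℝ) : ℝ :=
  ∑' z : LabelledExample d, (D z).toReal * ramp (f z.1) z.2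

/-- The error `Pr_{(x,y) ∼ D} (h x ≠ y)` of a classifier. -/
def err {d : ℕ} (D : PMF (LabelledExample d)) (h : Classifier d) : ℝ :=
  (D.toOuterMeasure {z | h z.1 ≠ z.2}).toReal

/-! ### The distributions -/

/-- `D` is `(k, B)`-realizable: for a set `κ` of at most `k` features and a vector `w` with
`‖w‖² ≤ B²`, almost surely the label is `1` if some feature in `κ` is positive, and otherwise
`y ⟨w, x⟩ ≥ 1`. -/
def IsRealizable {d : ℕ} (k : ℕ) (B : ℝ) (D : PMF (LabelledExample d)) : Prop :=
  ∃ (κ : Finset (Fin d)) (w : EuclideanSpace ℝ (Fin d)), κ.card ≤ k ∧ ‖w‖ ^ 2 ≤ B ^ 2 ∧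
    (∀ z ∈ D.support, (∃ j ∈ κ, 0 < z.1 j) → z.2 = 1) ∧
    (∀ z ∈ D.support, (∀ j ∈ κ, z.1 j ≤ 0) → 1 ≤ labelVal z.2 * inner ℝ w z.1)

/-- The instances lie in the Euclidean unit ball almost surely. -/
def InUnitBall {d : ℕ} (D : PMF (LabelledExample d)) : Prop := ∀ z ∈ D.support, ‖z.1‖ ≤ 1

/-- The law of `n` independent draws from `p`. -/
def iidSample {α : Type*} (p : PMF α) : (n : ℕ) → PMF (Fin n → α)
  | 0 => PMF.pure Fin.elim0
  | n + 1 => p.bind fun a => (iidSample p n).map fun v => Fin.cons a v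

/-! ### GreedyRule -/

/-- On the sample `S`, the coordinate `j` is a rule: `y_i = 1` whenever `x_i(j) > 0`. -/
def IsRule {d m : ℕ} (S : Fin m → LabelledExample d) (j : Fin d) : Prop :=
  ∀ i, 0 < (S i).1 j → (S i).2 = 1

open Classical in
/-- The (indices of the) examples of `S` covered by no rule in `κ`. -/
def nonCovered {d m : ℕ} (S : Fin m → LabelledExample d) (κ : Finset (Fin d)) : Finset (Fin m) :=
  Finset.univ.filter fun i => ∀ j ∈ κ, ¬ 0 < (S i).1 j

open Classical in
/-- `j` is a rule that covers more than `m / (100 k (B + 1))` of the examples not covered by `κ`.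
The inequality is multiplied out, so for `k = 0` no coordinate qualifies. -/
def CanAdd {d m : ℕ} (k : ℕ) (B : ℝ) (S : Fin m → LabelledExample d) (κ : Finset (Fin d))
    (j : Fin d) : Prop :=
  IsRule S j ∧
    (m : ℝ) < 100 * k * (B + 1) * (((nonCovered S κ).filter fun i => 0 < (S i).1 j).card : ℝ)

/-- The sets `κ` that the loop of GreedyRule can reach. -/
inductive Reachable {d m : ℕ} (k : ℕ) (B : ℝ) (S : Fin m → LabelledExample d) :
    Finset (Fin d) → Prop
  | init : Reachable k B S ∅
  | step (κ : Finset (Fin d)) (j : Fin d) :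
      Reachable k B S κ → CanAdd k B S κ j → Reachable k B S (insert j κ)

/-- The total hinge loss of `w` on the examples of `S` not covered by `κ`. -/
def hingeSum {d m : ℕ} (S : Fin m → LabelledExample d) (κ : Finset (Fin d))
    (w : EuclideanSpace ℝ (Fin d)) : ℝ :=
  ∑ i ∈ nonCovered S κ, hinge (inner ℝ w (S i).1) (S i).2

/-- `(κ, w)` is a possible output of GreedyRule on `S`: the loop has reached `κ` and stops there,
and `w` minimizes the hinge loss on the non-covered examples subject to `‖w‖² ≤ B²`. -/
def IsGreedyOutput {d m : ℕ} (k : ℕ) (B : ℝ) (S : Fin m → LabelledExample d)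
    (out : Finset (Fin d) × EuclideanSpace ℝ (Fin d)) : Prop :=
  Reachable k B S out.1 ∧ (∀ j, ¬ CanAdd k B S out.1 j) ∧
    ‖out.2‖ ^ 2 ≤ B ^ 2 ∧
    ∀ w : EuclideanSpace ℝ (Fin d), ‖w‖ ^ 2 ≤ B ^ 2 →
      hingeSum S out.1 out.2 ≤ hingeSum S out.1 w

/-- An implementation of GreedyRule: some resolution of the choices (order of the rules, choice of
the minimizer) that the algorithm leaves open, on samples of every size. -/
structure GreedyRule (d k : ℕ) (B : ℝ) where
  run : (m : ℕ) → (Fin m → LabelledExample d) → Finset (Fin d) × EuclideanSpace ℝ (Fin d)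
  isGreedyOutput : ∀ (m : ℕ) (S : Fin m → LabelledExample d), IsGreedyOutput k B S (run m S)

open Classical in
/-- The rules-first classifier of `(κ, w)`: the label is `1` if some feature in `κ` is positive,
and otherwise it is the sign of `⟨w, x⟩`. -/
def rulesFirst {d : ℕ} (out : Finset (Fin d) × EuclideanSpace ℝ (Fin d)) : Classifier d :=
  fun x => if ∃ j ∈ out.1, 0 < x j then 1 else sgn (inner ℝ out.2 x)

/-- The hypothesis that GreedyRule returns on `S`. -/
def GreedyRule.hyp {d k : ℕ} {B : ℝ} (G : GreedyRule d k B) {m : ℕ}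
    (S : Fin m → LabelledExample d) : Classifier d :=
  rulesFirst (G.run m S)

/-! ### BoostRule: AdaBoost (by resampling) with GreedyRule as the weak learner -/

/-- The AdaBoost distribution on the `n` training examples when the current weighted vote is `F`:
the weight of the `i`-th example is proportional to `exp (- y_i F(x_i))`. -/
def boostDist {d n : ℕ} (hn : 0 < n) (S : Fin n → LabelledExample d)
    (F : EuclideanSpace ℝ (Fin d) → ℝ) : PMF (Fin n) :=
  PMF.normalize (fun i => ENNReal.ofReal (Real.exp (-(labelVal (S i).2 * F (S i).1))))
    (fun h0 => by
      have h1 := ENNReal.tsum_eq_zero.mp h0 ⟨0, hn⟩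
      exact absurd (ENNReal.ofReal_eq_zero.mp h1) (not_le.mpr (Real.exp_pos _)))
    (by
      rw [tsum_fintype]
      exact ENNReal.sum_ne_top.mpr fun i _ => ENNReal.ofReal_ne_top)

/-- The weighted training error of `h` with respect to the current AdaBoost distribution. -/
def boostErr {d n : ℕ} (hn : 0 < n) (S : Fin n → LabelledExample d)
    (F : EuclideanSpace ℝ (Fin d) → ℝ) (h : Classifier d) : ℝ :=
  ∑ i, if h (S i).1 = (S i).2 then 0 else (boostDist hn S F i).toReal

/-- The remaining `T` rounds of AdaBoost, from the current weighted vote `F`. In each round `r`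
training examples are drawn independently from the current distribution, GreedyRule is run on them,
and its hypothesis `h`, of weighted training error `e`, enters the vote with weight
`(1/2) log ((1 - e) / e)`. If `e = 0` (so that `h` is correct on the whole training sample) `h` is
returned, and if `e ≥ 1/2` the loop stops with the current vote. -/
def adaBoost {d k : ℕ} {B : ℝ} (G : GreedyRule d k B) (r : ℕ) {n : ℕ} (hn : 0 < n)
    (S : Fin n → LabelledExample d) :
    ℕ → (EuclideanSpace ℝ (Fin d) → ℝ) → PMF (EuclideanSpace ℝ (Fin d) → ℝ)
  | 0, F => PMF.pure F
  | T + 1, F => (iidSample (boostDist hn S F) r).bind fun I =>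
      let h : Classifier d := G.hyp fun a => S (I a)
      let e : ℝ := boostErr hn S F h
      if e = 0 then PMF.pure fun x => labelVal (h x)
      else if 1 / 2 ≤ e then PMF.pure F
      else adaBoost G r hn S T fun x => F x + 1 / 2 * Real.log ((1 - e) / e) * labelVal (h x)

/-- BoostRule with `T` rounds and `r` examples per call of GreedyRule: the law, over the internal
randomness, of the classifier returned on the training sample `S`. -/
def boostRule {d k : ℕ} {B : ℝ} (G : GreedyRule d k B) (T r : ℕ) {n : ℕ}
    (S : Fin n → LabelledExample d) : PMF (Classifier d) :=
  if hn : 0 < n then (adaBoost G r hn S T fun _ => 0).map fun F x => sgn (F x)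
  else PMF.pure fun _ => 1

/-- `k B log (d + 1) + B²`. -/
def capacity (d k : ℕ) (B : ℝ) : ℝ := k * B * Real.log (d + 1) + B ^ 2

end

end RulesFirst

open RulesFirst

/-! Weak learner. Every rule that `GreedyRule` adds covers more than `m / (100k(B+1))` new examples,
so it uses at most `100k(B+1)` rules. When it stops, each realizing rule covers few of the remaining
examples. The realizing vector has hinge loss at most `1 + B` on these and zero on the others, so
the minimizer has total hinge loss at most `m / 100`.

Generalization of the linear part must not depend on the dimension, and it is obtained by random
rounding. For a uniform sign array `ω`, `roundVec ω` is a random vector. Biasing the signs gives it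
mean `w`, and by Chebyshev it is then close to `⟨w, x⟩` at most points `x`, both under the
distribution and on the sample. The biased law has second moment at most `exp (3600 B²)` times the
uniform one, so by Cauchy–Schwarz the good roundings form a fraction of at least `exp (-3600 B²) /
4` of all sign arrays (`exists_finset_roundVec`). If `GreedyRule` fails on a sample, then for its
rule set at least this fraction of the fixed pairs (rule set, `ω`) has large true loss and small
empirical loss. A Chernoff bound for each fixed pair, averaged over `ω` and summed over rule sets,
gives `greedyRule_failure_le`, where the number of sign arrays cancels.

Boosting. A reweighted sample is still supported on realizable examples, so the weak learner applies
in each round. Errors of at most `1/4` shrink the exponential loss by `7/8`; after `O(log n)` rounds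
it is below `1`, and the vote is then correct on the sample. This vote is a compression of the
sample: it is determined by the `T * r` drawn indices and the set of sign patterns of the voters
that it accepts. There are at most `(2^T + 1)^T` such sets by Sauer–Shelah, so consistency implies
small error (`compression_failure_le`). The cube of the logarithm comes from the rounds, the draws
per round and the logarithm of the number of choices of an index. -/

namespace RulesFirst

open scoped ENNReal

/-! ### Expectations with respect to a `PMF` -/

/-- The expectation of an extended nonnegative function under a `PMF`. -/
noncomputable def pexp {α : Type*} (p : PMF α) (f : α → ℝ≥0∞) : ℝ≥0∞ := ∑' x, p x * f x

section pexp

variable {α β : Type*}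

theorem pexp_mono_support (p : PMF α) {f g : α → ℝ≥0∞} (h : ∀ x ∈ p.support, f x ≤ g x) :
    pexp p f ≤ pexp p g := by
  refine ENNReal.tsum_le_tsum fun x => ?_
  by_cases hx : p x = 0
  · simp [hx]
  · gcongr
    exact h x ((PMF.mem_support_iff p x).2 hx)

theorem pexp_mono (p : PMF α) {f g : α → ℝ≥0∞} (h : ∀ x, f x ≤ g x) : pexp p f ≤ pexp p g :=
  pexp_mono_support p fun x _ => h x

theorem pexp_const (p : PMF α) (c : ℝ≥0∞) : pexp p (fun _ => c) = c := by
  rw [pexp, ENNReal.tsum_mul_right, p.tsum_coe, one_mul]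

theorem pexp_const_mul (p : PMF α) (c : ℝ≥0∞) (f : α → ℝ≥0∞) :
    pexp p (fun x => c * f x) = c * pexp p f := by
  rw [pexp, pexp, ← ENNReal.tsum_mul_left]
  exact tsum_congr fun x => by ring

theorem pexp_add (p : PMF α) (f g : α → ℝ≥0∞) :
    pexp p (fun x => f x + g x) = pexp p f + pexp p g := by
  simp only [pexp, mul_add, ENNReal.tsum_add]

theorem pexp_finset_sum {ι : Type*} (p : PMF α) (s : Finset ι) (f : ι → α → ℝ≥0∞) :
    pexp p (fun x => ∑ i ∈ s, f i x) = ∑ i ∈ s, pexp p (f i) := by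
  simp only [pexp, Finset.mul_sum]
  exact Summable.tsum_finsetSum fun _ _ => ENNReal.summable

theorem pexp_pure (a : α) (f : α → ℝ≥0∞) : pexp (PMF.pure a) f = f a := by
  classical
  rw [pexp, tsum_eq_single a]
  · simp
  · intro b hb
    simp [PMF.pure_apply, hb]

theorem pexp_bind (p : PMF α) (q : α → PMF β) (f : β → ℝ≥0∞) :
    pexp (p.bind q) f = pexp p fun a => pexp (q a) f := by
  simp only [pexp, PMF.bind_apply, ← ENNReal.tsum_mul_right, ← ENNReal.tsum_mul_left]
  rw [ENNReal.tsum_comm]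
  exact tsum_congr fun a => tsum_congr fun b => by ring

theorem pexp_map (p : PMF α) (g : α → β) (f : β → ℝ≥0∞) :
    pexp (p.map g) f = pexp p fun a => f (g a) := by
  rw [PMF.map, pexp_bind]
  simp only [Function.comp_apply, pexp_pure]

theorem pexp_comm (p : PMF α) (q : PMF β) (f : α → β → ℝ≥0∞) :
    pexp p (fun a => pexp q (f a)) = pexp q fun b => pexp p fun a => f a b := by
  simp only [pexp, ← ENNReal.tsum_mul_left]
  rw [ENNReal.tsum_comm]
  exact tsum_congr fun a => tsum_congr fun b => by ring

theorem pexp_fintype [Fintype α] (p : PMF α) (f : α → ℝ≥0∞) : pexp p f = ∑ x, p x * f x :=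
  tsum_fintype _

theorem toOuterMeasure_eq_pexp (p : PMF α) (s : Set α) :
    p.toOuterMeasure s = pexp p (s.indicator 1) := by
  rw [PMF.toOuterMeasure_apply, pexp]
  refine tsum_congr fun x => ?_
  by_cases hx : x ∈ s <;> simp [hx]

theorem toOuterMeasure_le_pexp (p : PMF α) {s : Set α} {f : α → ℝ≥0∞}
    (h : ∀ x ∈ p.support, x ∈ s → 1 ≤ f x) : p.toOuterMeasure s ≤ pexp p f := by
  rw [toOuterMeasure_eq_pexp]
  refine pexp_mono_support p fun x hx => ?_
  by_cases hs : x ∈ s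
  · simpa [hs] using h x hx hs
  · simp [hs]

theorem toOuterMeasure_mono_support (p : PMF α) {s t : Set α}
    (h : ∀ x ∈ p.support, x ∈ s → x ∈ t) : p.toOuterMeasure s ≤ p.toOuterMeasure t := by
  rw [toOuterMeasure_eq_pexp p t]
  exact toOuterMeasure_le_pexp p fun x hx hs => by simp [h x hx hs]

theorem toOuterMeasure_le_one (p : PMF α) (s : Set α) : p.toOuterMeasure s ≤ 1 :=
  (toOuterMeasure_le_pexp p (f := fun _ => 1) fun _ _ _ => le_rfl).trans (pexp_const p 1).le

theorem toOuterMeasure_add_compl (p : PMF α) (s : Set α) :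
    p.toOuterMeasure s + p.toOuterMeasure sᶜ = 1 := by
  rw [toOuterMeasure_eq_pexp, toOuterMeasure_eq_pexp, ← pexp_add, ← pexp_const p 1]
  congr 1
  funext x
  by_cases hs : x ∈ s <;> simp [hs]

theorem ofReal_one_sub_le_toOuterMeasure (p : PMF α) {s : Set α} {δ : ℝ} (hδ : 0 ≤ δ)
    (h : p.toOuterMeasure sᶜ ≤ ENNReal.ofReal δ) :
    ENNReal.ofReal (1 - δ) ≤ p.toOuterMeasure s := by
  rw [ENNReal.ofReal_sub _ hδ, ENNReal.ofReal_one, tsub_le_iff_right,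
    ← toOuterMeasure_add_compl p s]
  gcongr

end pexp

/-! ### Independent samples -/

section iid

variable {α β : Type*}

theorem mem_support_of_mem_support_iidSample (p : PMF α) :
    ∀ (n : ℕ) (S : Fin n → α), S ∈ (iidSample p n).support → ∀ i, S i ∈ p.support
  | 0, _, _, i => i.elim0
  | n + 1, S, hS, i => by
    simp only [iidSample, PMF.mem_support_bind_iff, PMF.mem_support_map_iff] at hS
    obtain ⟨a, ha, v, hv, rfl⟩ := hS
    refine Fin.cases ?_ (fun j => ?_) i
    · simpa using ha
    · simpa using mem_support_of_mem_support_iidSample p n v hv j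

theorem iidSample_map (p : PMF α) (g : α → β) :
    ∀ n : ℕ, iidSample (p.map g) n = (iidSample p n).map fun v i => g (v i)
  | 0 => by
    rw [iidSample, iidSample, PMF.pure_map]
    congr 1
    exact Subsingleton.elim _ _
  | n + 1 => by
    simp only [iidSample, iidSample_map p g n, PMF.bind_map, PMF.map_bind, PMF.map_comp]
    congr 1
    funext a
    simp only [Function.comp_def]
    congr 1
    funext v i
    refine Fin.cases ?_ (fun j => ?_) i <;> simp

/-- If `f S` depends only on the examples of `S` with index in `J`, then the examples with index
outside `J` are fresh. -/
theorem pexp_iidSample_prod_le (p : PMF α) (ρ : ℝ≥0∞) :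
    ∀ (n : ℕ) (J : Finset (Fin n)) (f : (Fin n → α) → α → ℝ≥0∞),
      (∀ S S' : Fin n → α, (∀ i ∈ J, S i = S' i) → f S = f S') →
      (∀ S, pexp p (f S) ≤ ρ) →
      pexp (iidSample p n) (fun S => ∏ i, if i ∈ J then 1 else f S (S i)) ≤ ρ ^ (n - J.card)
  | 0, J, f, _, _ => by
    simp [iidSample, pexp_pure]
  | n + 1, J, f, hJ, hf => by
    classical
    let J' : Finset (Fin n) := Finset.univ.filter fun i => i.succ ∈ J
    have hmem : ∀ i : Fin n, i ∈ J' ↔ i.succ ∈ J := fun i => by simp [J']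
    have hdep : ∀ a, ∀ v v' : Fin n → α, (∀ i ∈ J', v i = v' i) →
        f (Fin.cons a v) = f (Fin.cons a v') := by
      intro a v v' h
      refine hJ _ _ fun i hi => ?_
      induction i using Fin.cases with
      | zero => simp
      | succ i => simpa using h i ((hmem i).2 hi)
    have hIH : ∀ a, pexp (iidSample p n)
        (fun v => ∏ i, if i ∈ J' then 1 else f (Fin.cons a v) (v i)) ≤ ρ ^ (n - J'.card) := fun a =>
      pexp_iidSample_prod_le p ρ n J' (fun v => f (Fin.cons a v)) (hdep a) fun v => hf _
    have hcard : J.card = J'.card + if (0 : Fin (n + 1)) ∈ J then 1 else 0 := by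
      have h1 := Fin.sum_univ_succ fun i : Fin (n + 1) => if i ∈ J then 1 else 0
      simp only [Finset.sum_boole, Finset.filter_mem_eq_inter, Finset.univ_inter, Nat.cast_id] at h1
      rw [h1, add_comm]
    simp only [iidSample, pexp_bind, pexp_map, Fin.prod_univ_succ, Fin.cons_zero, Fin.cons_succ,
      ← hmem]
    -- If the head belongs to `J`, condition on it. Otherwise `f` does not depend on it, so it is
    -- replaced by a dummy `a₀` and integrated out, which contributes one factor `ρ`.
    by_cases h0 : (0 : Fin (n + 1)) ∈ J
    · simp only [h0, if_true, one_mul] at hcard ⊢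
      rw [hcard, Nat.add_sub_add_right]
      exact (pexp_mono p hIH).trans (pexp_const p _).le
    · simp only [h0, if_false, add_zero] at hcard ⊢
      have hle : J'.card ≤ n := by simpa using Finset.card_le_univ J'
      obtain ⟨a₀, -⟩ := p.support_nonempty
      have hf0 : ∀ a v, f (Fin.cons a v) = f (Fin.cons a₀ v) := by
        intro a v
        refine hJ _ _ fun i hi => ?_
        induction i using Fin.cases with
        | zero => exact absurd hi h0
        | succ i => simp
      simp only [hf0]
      rw [pexp_comm, hcard, Nat.sub_add_comm hle, pow_succ, mul_comm]
      calc _ ≤ pexp (iidSample p n) (fun v => ρ * ∏ i, if i ∈ J' then 1 else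
              f (Fin.cons a₀ v) (v i)) := by
            refine pexp_mono _ fun v => ?_
            simp only [mul_comm (f (Fin.cons a₀ v) _)]
            rw [pexp_const_mul, mul_comm]
            gcongr
            exact hf _
        _ ≤ _ := by
            rw [pexp_const_mul]
            gcongr
            exact hIH a₀

end iid

end RulesFirst

namespace RulesFirst

open scoped ENNReal

/-! ### Biased signs -/

section tilt

variable {ι : Type*} [Fintype ι]

theorem labelVal_one : labelVal 1 = 1 := by simp [labelVal]

theorem labelVal_neg_one : labelVal (-1) = -1 := by simp [labelVal]

theorem abs_labelVal (y : ℤˣ) : |labelVal y| = 1 := by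
  rcases Int.units_eq_one_or y with rfl | rfl <;> simp [labelVal]

theorem sum_units (f : ℤˣ → ℝ) : ∑ y, f y = f 1 + f (-1) := by
  have h : (Finset.univ : Finset ℤˣ) = {1, -1} := by decide
  rw [h, Finset.sum_pair (by decide)]

/-- The law of independent signs with means `μ i`. -/
noncomputable def tilt (μ : ι → ℝ) (ω : ι → ℤˣ) : ℝ := ∏ i, (1 + μ i * labelVal (ω i)) / 2

theorem tilt_nonneg {μ : ι → ℝ} (hμ : ∀ i, |μ i| ≤ 1) (ω : ι → ℤˣ) : 0 ≤ tilt μ ω := by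
  refine Finset.prod_nonneg fun i _ => ?_
  have h := abs_le.1 (hμ i)
  rcases Int.units_eq_one_or (ω i) with hy | hy <;> rw [hy] <;> simp only [labelVal_one,
    labelVal_neg_one] <;> linarith

variable [DecidableEq ι]

theorem sum_prod_pi (f : ι → ℤˣ → ℝ) : ∑ ω : ι → ℤˣ, ∏ i, f i (ω i) = ∏ i, ∑ y, f i y := by
  rw [Finset.prod_univ_sum, Fintype.piFinset_univ]

theorem sum_tilt (μ : ι → ℝ) : ∑ ω, tilt μ ω = 1 := by
  unfold tilt
  rw [sum_prod_pi fun i y => (1 + μ i * labelVal y) / 2]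
  refine Finset.prod_eq_one fun i _ => ?_
  rw [sum_units, labelVal_one, labelVal_neg_one]
  ring

/-- Each coordinate contributes `(1 + μ²) / 2 ≤ exp (μ²) / 2`. This measures how far the biased law
is from uniform. -/
theorem sum_tilt_sq_le (μ : ι → ℝ) :
    ∑ ω, tilt μ ω ^ 2 ≤ Real.exp (∑ i, μ i ^ 2) / 2 ^ Fintype.card ι := by
  simp only [tilt, ← Finset.prod_pow]
  rw [sum_prod_pi fun i y => ((1 + μ i * labelVal y) / 2) ^ 2, Real.exp_sum, ← Finset.card_univ,
    ← Finset.prod_const, ← Finset.prod_div_distrib]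
  refine Finset.prod_le_prod (fun i _ => ?_) fun i _ => ?_
  · exact Finset.sum_nonneg fun _ _ => sq_nonneg _
  · rw [sum_units, labelVal_one, labelVal_neg_one]
    have := Real.add_one_le_exp (μ i ^ 2)
    nlinarith

theorem sum_tilt_mul_sub_mul_sub (μ : ι → ℝ) {i k : ι} (hik : i ≠ k) :
    ∑ ω, tilt μ ω * ((labelVal (ω i) - μ i) * (labelVal (ω k) - μ k)) = 0 := by
  have h : ∀ ω : ι → ℤˣ, tilt μ ω * ((labelVal (ω i) - μ i) * (labelVal (ω k) - μ k)) =
      ∏ l, (1 + μ l * labelVal (ω l)) / 2 *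
        ((if l = i then labelVal (ω l) - μ l else 1) *
          (if l = k then labelVal (ω l) - μ l else 1)) := by
    intro ω
    rw [Finset.prod_mul_distrib, Finset.prod_mul_distrib, Finset.prod_ite_eq' _ i,
      Finset.prod_ite_eq' _ k]
    simp [tilt]
  simp only [h]
  rw [sum_prod_pi fun l y => (1 + μ l * labelVal y) / 2 *
        ((if l = i then labelVal y - μ l else 1) * (if l = k then labelVal y - μ l else 1))]
  refine Finset.prod_eq_zero (Finset.mem_univ i) ?_
  simp only [if_true, if_neg hik, sum_units, labelVal_one, labelVal_neg_one]
  ring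

theorem sum_tilt_mul_sub_sq_le {μ : ι → ℝ} (hμ : ∀ i, |μ i| ≤ 1) (i : ι) :
    ∑ ω, tilt μ ω * (labelVal (ω i) - μ i) ^ 2 ≤ 1 := by
  have h : ∀ ω : ι → ℤˣ, tilt μ ω * (labelVal (ω i) - μ i) ^ 2 =
      ∏ l, (1 + μ l * labelVal (ω l)) / 2 *
        (if l = i then (labelVal (ω l) - μ l) ^ 2 else 1) := by
    intro ω
    rw [Finset.prod_mul_distrib, Finset.prod_ite_eq' _ i]
    simp [tilt]
  simp only [h]
  rw [sum_prod_pi fun l y => (1 + μ l * labelVal y) / 2 *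
        (if l = i then (labelVal y - μ l) ^ 2 else 1)]
  refine Finset.prod_le_one (fun l _ => ?_) fun l _ => ?_
  · by_cases hl : l = i
    · simp only [hl, if_true, sum_units, labelVal_one, labelVal_neg_one]
      have := (sq_le_one_iff_abs_le_one _).2 (hμ i)
      nlinarith
    · simp only [hl, if_false, sum_units, labelVal_one, labelVal_neg_one]
      linarith
  · by_cases hl : l = i
    · simp only [hl, if_true, sum_units, labelVal_one, labelVal_neg_one]
      nlinarith [sq_nonneg (μ i)]
    · simp only [hl, if_false, sum_units, labelVal_one, labelVal_neg_one]
      linarith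

/-- The centred signs are uncorrelated with variance at most `1`, so only the diagonal of the
expanded square survives. -/
theorem sum_tilt_mul_sq_le {μ : ι → ℝ} (hμ : ∀ i, |μ i| ≤ 1) (a : ι → ℝ) :
    ∑ ω, tilt μ ω * (∑ i, a i * (labelVal (ω i) - μ i)) ^ 2 ≤ ∑ i, a i ^ 2 := by
  have h : ∀ ω : ι → ℤˣ, tilt μ ω * (∑ i, a i * (labelVal (ω i) - μ i)) ^ 2 =
      ∑ i, ∑ k, a i * a k * (tilt μ ω * ((labelVal (ω i) - μ i) * (labelVal (ω k) - μ k))) := by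
    intro ω
    rw [sq, Finset.sum_mul_sum, Finset.mul_sum]
    refine Finset.sum_congr rfl fun i _ => ?_
    rw [Finset.mul_sum]
    exact Finset.sum_congr rfl fun k _ => by ring
  simp only [h]
  rw [Finset.sum_comm]
  refine Finset.sum_le_sum fun i _ => ?_
  rw [Finset.sum_comm, Finset.sum_eq_single i]
  · rw [← Finset.mul_sum]
    have := sum_tilt_mul_sub_sq_le hμ i
    simp only [← sq] at this ⊢
    exact (mul_le_mul_of_nonneg_left this (sq_nonneg _)).trans_eq (by ring)
  · intro k _ hk
    rw [← Finset.mul_sum, sum_tilt_mul_sub_mul_sub μ hk.symm, mul_zero]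
  · simp

/-- Cauchy–Schwarz turns mass under the biased law into cardinality: a set of mass `1/2` fills a
fraction `exp (-∑ μ²) / 4` of the cube. -/
theorem sq_sum_tilt_le (μ : ι → ℝ) (A : Finset (ι → ℤˣ)) :
    (∑ ω ∈ A, tilt μ ω) ^ 2 ≤ A.card * (Real.exp (∑ i, μ i ^ 2) / 2 ^ Fintype.card ι) := by
  refine sq_sum_le_card_mul_sum_sq.trans ?_
  gcongr
  exact (Finset.sum_le_univ_sum_of_nonneg fun ω => sq_nonneg _).trans (sum_tilt_sq_le μ)

/-- Chebyshev's inequality for a linear combination of biased signs. -/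
theorem sum_tilt_filter_le {μ : ι → ℝ} (hμ : ∀ i, |μ i| ≤ 1) (a : ι → ℝ) {t : ℝ} (ht : 0 < t)
    (A : Finset (ι → ℤˣ)) (hA : ∀ ω ∈ A, t ≤ |∑ i, a i * (labelVal (ω i) - μ i)|) :
    ∑ ω ∈ A, tilt μ ω ≤ (∑ i, a i ^ 2) / t ^ 2 := by
  rw [le_div_iff₀ (by positivity), Finset.sum_mul]
  refine le_trans ?_ (sum_tilt_mul_sq_le hμ a)
  refine le_trans (Finset.sum_le_sum fun ω hω => ?_) (Finset.sum_le_univ_sum_of_nonneg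
    (s := A) fun ω => mul_nonneg (tilt_nonneg hμ ω) (sq_nonneg _))
  refine mul_le_mul_of_nonneg_left ?_ (tilt_nonneg hμ ω)
  rw [← sq_abs (∑ i, _)]
  gcongr
  exact hA ω hω

end tilt

end RulesFirst

namespace RulesFirst

open scoped ENNReal

/-! ### Random rounding of a vector -/

section round

variable {d N : ℕ}

/-- The vector whose coordinates are normalized sums of `N` signs. -/
noncomputable def roundVec (ω : Fin d × Fin N → ℤˣ) : EuclideanSpace ℝ (Fin d) :=
  WithLp.toLp 2 fun j => 1 / (60 * √N) * ∑ a, labelVal (ω (j, a))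

/-- The means of the signs for which `roundVec` has mean `w`. -/
noncomputable def roundMean (N : ℕ) (w : EuclideanSpace ℝ (Fin d)) (i : Fin d × Fin N) : ℝ :=
  60 * w i.1 / √N

theorem inner_eq_sum (u x : EuclideanSpace ℝ (Fin d)) : inner ℝ u x = ∑ j, u j * x j := by
  simp [PiLp.inner_apply, mul_comm]

theorem norm_sq_eq_sum (x : EuclideanSpace ℝ (Fin d)) : ‖x‖ ^ 2 = ∑ j, x j ^ 2 := by
  simp [EuclideanSpace.norm_sq_eq]

theorem inner_roundVec_sub (hN : 0 < N) (w x : EuclideanSpace ℝ (Fin d))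
    (ω : Fin d × Fin N → ℤˣ) :
    inner ℝ (roundVec ω - w) x =
      ∑ i, x i.1 / (60 * √N) * (labelVal (ω i) - roundMean N w i) := by
  have hs : (√N : ℝ) ≠ 0 := by positivity
  have hN' : (N : ℝ) = √N * √N := (Real.mul_self_sqrt (Nat.cast_nonneg N)).symm
  rw [inner_eq_sum, Fintype.sum_prod_type]
  refine Finset.sum_congr rfl fun j _ => ?_
  simp only [roundMean, ← Finset.mul_sum, Finset.sum_sub_distrib, Finset.sum_const,
    Finset.card_univ, Fintype.card_fin, nsmul_eq_mul]
  simp only [PiLp.sub_apply, roundVec]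
  have : (N : ℝ) * (60 * w j / √N) = 60 * w j * √N := by
    rw [← mul_div_assoc, div_eq_iff hs]
    linear_combination 60 * w j * hN'
  rw [this]
  field_simp

/-- This bounds the variance of `⟨roundVec ω, x⟩`. The constant `60` makes Chebyshev at distance
`1/3` give `9 / 3600 = 1 / 400`. -/
theorem sum_roundVec_coeff_sq (hN : 0 < N) (x : EuclideanSpace ℝ (Fin d)) :
    ∑ i : Fin d × Fin N, (x i.1 / (60 * √N)) ^ 2 = ‖x‖ ^ 2 / 3600 := by
  have hN' : (√N : ℝ) ^ 2 = N := Real.sq_sqrt (Nat.cast_nonneg N)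
  have hN0 : (N : ℝ) ≠ 0 := by positivity
  rw [Fintype.sum_prod_type, norm_sq_eq_sum, Finset.sum_div]
  refine Finset.sum_congr rfl fun j _ => ?_
  simp only [Finset.sum_const, Finset.card_univ, Fintype.card_fin, nsmul_eq_mul]
  rw [div_pow, mul_pow, hN']
  field_simp
  norm_num

/-- This is the exponent paid for biasing the signs. It involves neither `d` nor `N`; `N` need only
be large enough for the means to lie in `[-1, 1]`. -/
theorem sum_roundMean_sq (hN : 0 < N) (w : EuclideanSpace ℝ (Fin d)) :
    ∑ i, roundMean N w i ^ 2 = 3600 * ‖w‖ ^ 2 := by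
  have hN' : (√N : ℝ) ^ 2 = N := Real.sq_sqrt (Nat.cast_nonneg N)
  have hN0 : (N : ℝ) ≠ 0 := by positivity
  rw [Fintype.sum_prod_type, norm_sq_eq_sum, Finset.mul_sum]
  refine Finset.sum_congr rfl fun j _ => ?_
  simp only [roundMean, Finset.sum_const, Finset.card_univ, Fintype.card_fin, nsmul_eq_mul]
  rw [div_pow, mul_pow, hN']
  field_simp
  ring

theorem abs_roundMean_le {B : ℝ} (hN : 0 < N) (hB : 60 * B ≤ √N)
    {w : EuclideanSpace ℝ (Fin d)} (hw : ‖w‖ ≤ B) (i : Fin d × Fin N) :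
    |roundMean N w i| ≤ 1 := by
  have hs : (0 : ℝ) < √N := by positivity
  have h1 : |w i.1| ≤ ‖w‖ := by simpa using PiLp.norm_apply_le w i.1
  rw [roundMean, abs_div, abs_mul, abs_of_pos hs, div_le_one hs]
  norm_num
  linarith

/-- The set of signs whose rounding differs much from `w` on many points. -/
theorem sum_tilt_roundVec_bad_le {B : ℝ} (hN : 0 < N) (hB : 60 * B ≤ √N)
    {w : EuclideanSpace ℝ (Fin d)} (hw : ‖w‖ ≤ B) {γ : Type*} (p : PMF γ)
    (X : γ → EuclideanSpace ℝ (Fin d)) (hX : ∀ z ∈ p.support, ‖X z‖ ≤ 1)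
    (A : Finset (Fin d × Fin N → ℤˣ))
    (hA : ∀ ω ∈ A, ENNReal.ofReal (1 / 100) ≤
      p.toOuterMeasure {z | 1 / 3 ≤ |inner ℝ (roundVec ω - w) (X z)|}) :
    ∑ ω ∈ A, tilt (roundMean N w) ω ≤ 1 / 4 := by
  classical
  have hμ := abs_roundMean_le hN hB hw
  have h1 : ENNReal.ofReal (1 / 100 * ∑ ω ∈ A, tilt (roundMean N w) ω) ≤
      ENNReal.ofReal (1 / 400) := by
    -- Markov's inequality with the sums over `ω` and `z` exchanged: for each fixed `z`, Chebyshev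
    -- bounds the mass of the far roundings by `1 / 400`.
    calc ENNReal.ofReal (1 / 100 * ∑ ω ∈ A, tilt (roundMean N w) ω)
        = ∑ ω ∈ A, ENNReal.ofReal (tilt (roundMean N w) ω) * ENNReal.ofReal (1 / 100) := by
          rw [mul_comm, ENNReal.ofReal_mul' (by norm_num),
            ENNReal.ofReal_sum_of_nonneg fun ω _ => tilt_nonneg hμ ω, Finset.sum_mul]
      _ ≤ ∑ ω ∈ A, ENNReal.ofReal (tilt (roundMean N w) ω) *
            pexp p ({z | 1 / 3 ≤ |inner ℝ (roundVec ω - w) (X z)|}.indicator 1) := by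
          refine Finset.sum_le_sum fun ω hω => ?_
          rw [← toOuterMeasure_eq_pexp]
          gcongr
          exact hA ω hω
      _ = pexp p fun z => ∑ ω ∈ A, ENNReal.ofReal (tilt (roundMean N w) ω) *
            {z | 1 / 3 ≤ |inner ℝ (roundVec ω - w) (X z)|}.indicator 1 z := by
          rw [pexp_finset_sum]
          simp only [pexp_const_mul]
      _ ≤ pexp p fun _ => ENNReal.ofReal (1 / 400) := by
          refine pexp_mono_support p fun z hz => ?_
          have h2 := sum_tilt_filter_le hμ (fun i => X z i.1 / (60 * √N))
            (t := 1 / 3) (by norm_num)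
            (A.filter fun ω => 1 / 3 ≤ |inner ℝ (roundVec ω - w) (X z)|) (fun ω hω => by
              rw [← inner_roundVec_sub hN]
              exact (Finset.mem_filter.1 hω).2)
          rw [sum_roundVec_coeff_sq hN] at h2
          have h3 : ‖X z‖ ^ 2 ≤ 1 := pow_le_one₀ (norm_nonneg _) (hX z hz)
          have h4 : ∑ ω ∈ A, ENNReal.ofReal (tilt (roundMean N w) ω) *
              {z | 1 / 3 ≤ |inner ℝ (roundVec ω - w) (X z)|}.indicator 1 z =
              ENNReal.ofReal (∑ ω ∈ A.filter fun ω => 1 / 3 ≤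
                |inner ℝ (roundVec ω - w) (X z)|, tilt (roundMean N w) ω) := by
            rw [ENNReal.ofReal_sum_of_nonneg fun ω _ => tilt_nonneg hμ ω, Finset.sum_filter]
            refine Finset.sum_congr rfl fun ω _ => ?_
            simp [Set.indicator_apply]
          rw [h4]
          apply ENNReal.ofReal_le_ofReal
          refine h2.trans ?_
          norm_num
          linarith
      _ = ENNReal.ofReal (1 / 400) := pexp_const p _
  have h2 := (ENNReal.ofReal_le_ofReal_iff (by norm_num)).1 h1
  linarith

/-- A substantial fraction of the sign vectors round to a vector that is close to `w` on most
points, under two distributions at the same time. -/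
theorem exists_finset_roundVec {B : ℝ} (hN : 0 < N) (hB : 60 * B ≤ √N)
    {w : EuclideanSpace ℝ (Fin d)} (hw : ‖w‖ ≤ B) {γ γ' : Type*} (p : PMF γ) (q : PMF γ')
    (X : γ → EuclideanSpace ℝ (Fin d)) (hX : ∀ z ∈ p.support, ‖X z‖ ≤ 1)
    (Y : γ' → EuclideanSpace ℝ (Fin d)) (hY : ∀ z ∈ q.support, ‖Y z‖ ≤ 1) :
    ∃ A : Finset (Fin d × Fin N → ℤˣ),
      Real.exp (-(3600 * B ^ 2)) / 4 * 2 ^ (d * N) ≤ (A.card : ℝ) ∧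
      ∀ ω ∈ A, p.toOuterMeasure {z | 1 / 3 ≤ |inner ℝ (roundVec ω - w) (X z)|} ≤
          ENNReal.ofReal (1 / 100) ∧
        q.toOuterMeasure {z | 1 / 3 ≤ |inner ℝ (roundVec ω - w) (Y z)|} ≤
          ENNReal.ofReal (1 / 100) := by
  classical
  let A₁ : Finset (Fin d × Fin N → ℤˣ) := Finset.univ.filter fun ω => ENNReal.ofReal (1 / 100) ≤
      p.toOuterMeasure {z | 1 / 3 ≤ |inner ℝ (roundVec ω - w) (X z)|}
  let A₂ : Finset (Fin d × Fin N → ℤˣ) := Finset.univ.filter fun ω => ENNReal.ofReal (1 / 100) ≤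
      q.toOuterMeasure {z | 1 / 3 ≤ |inner ℝ (roundVec ω - w) (Y z)|}
  have h1 := sum_tilt_roundVec_bad_le hN hB hw p X hX A₁ fun ω hω => (Finset.mem_filter.1 hω).2
  have h2 := sum_tilt_roundVec_bad_le hN hB hw q Y hY A₂ fun ω hω => (Finset.mem_filter.1 hω).2
  have hμ := abs_roundMean_le hN hB hw
  refine ⟨(A₁ ∪ A₂)ᶜ, ?_, fun ω hω => ?_⟩
  -- Each bad set has mass at most `1/4`, so the good roundings keep mass `1/2`, to which
  -- `sq_sum_tilt_le` applies.
  · have h3 : ∑ ω ∈ A₁ ∪ A₂, tilt (roundMean N w) ω ≤ 1 / 2 := by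
      have := Finset.sum_union_inter (s₁ := A₁) (s₂ := A₂) (f := tilt (roundMean N w))
      have h4 : 0 ≤ ∑ ω ∈ A₁ ∩ A₂, tilt (roundMean N w) ω :=
        Finset.sum_nonneg fun ω _ => tilt_nonneg hμ ω
      linarith
    have h4 := Finset.sum_add_sum_compl (A₁ ∪ A₂) (tilt (roundMean N w))
    rw [sum_tilt] at h4
    have h5 := sq_sum_tilt_le (roundMean N w) (A₁ ∪ A₂)ᶜ
    rw [sum_roundMean_sq hN, Fintype.card_prod, Fintype.card_fin, Fintype.card_fin] at h5
    have h6 : (1 / 4 : ℝ) ≤ (∑ ω ∈ (A₁ ∪ A₂)ᶜ, tilt (roundMean N w) ω) ^ 2 := by nlinarith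
    have h7 : Real.exp (3600 * ‖w‖ ^ 2) ≤ Real.exp (3600 * B ^ 2) := by gcongr
    have h8 : (1 / 4 : ℝ) ≤ ((A₁ ∪ A₂)ᶜ.card : ℝ) * (Real.exp (3600 * B ^ 2) / 2 ^ (d * N)) :=
      h6.trans (h5.trans (by gcongr))
    rw [Real.exp_neg]
    have h9 := Real.exp_pos (3600 * B ^ 2)
    field_simp at h8 ⊢
    linarith
  · simp only [A₁, A₂, Finset.mem_compl, Finset.mem_union, Finset.mem_filter, Finset.mem_univ,
      true_and, not_or, not_le] at hω
    exact ⟨hω.1.le, hω.2.le⟩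

end round

end RulesFirst

namespace RulesFirst

open scoped ENNReal

/-! ### The output of GreedyRule on a realizable sample -/

section greedy

variable {d m k : ℕ} {B : ℝ} {S : Fin m → LabelledExample d}

theorem Reachable.isRule {κ : Finset (Fin d)} (h : Reachable k B S κ) : ∀ j ∈ κ, IsRule S j := by
  induction h with
  | init => simp
  | step κ j _ hj ih =>
    intro l hl
    rcases Finset.mem_insert.1 hl with rfl | hl
    · exact hj.1
    · exact ih l hl

open Classical in
theorem nonCovered_insert (κ : Finset (Fin d)) (j : Fin d) :
    (nonCovered S (insert j κ)).card +
      ((nonCovered S κ).filter fun i => 0 < (S i).1 j).card = (nonCovered S κ).card := by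
  rw [← Finset.card_filter_add_card_filter_not (s := nonCovered S κ) (fun i => 0 < (S i).1 j),
    add_comm]
  congr 2
  ext i
  simp only [nonCovered, Finset.mem_filter, Finset.mem_univ, true_and, Finset.mem_insert,
    forall_eq_or_imp]
  exact and_comm

/-- Potential argument: every added rule pays for itself with newly covered examples. -/
theorem Reachable.card_mul_le {κ : Finset (Fin d)} (h : Reachable k B S κ) :
    (m : ℝ) * κ.card ≤ 100 * k * (B + 1) * (m - (nonCovered S κ).card) := by
  classical
  induction h with
  | init => simp [nonCovered]
  | step κ j _ hj ih =>
    have h1 : ((insert j κ).card : ℝ) ≤ κ.card + 1 := by exact_mod_cast Finset.card_insert_le j κ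
    have h2 := nonCovered_insert (S := S) κ j
    have h3 := hj.2
    have h4 : ((nonCovered S (insert j κ)).card : ℝ) +
      (((nonCovered S κ).filter fun i => 0 < (S i).1 j).card : ℝ) = (nonCovered S κ).card := by
      exact_mod_cast h2
    calc (m : ℝ) * (insert j κ).card ≤ m * κ.card + m := by nlinarith [Nat.cast_nonneg (α := ℝ) m]
      _ ≤ 100 * k * (B + 1) * (m - (nonCovered S κ).card) + 100 * k * (B + 1) *
        (((nonCovered S κ).filter fun i => 0 < (S i).1 j).card : ℝ) := by
          refine add_le_add ih ?_
          convert h3.le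
      _ = _ := by rw [← h4]; ring

theorem Reachable.card_le (hm : 0 < m) (hB : 1 ≤ B) {κ : Finset (Fin d)}
    (h : Reachable k B S κ) : (κ.card : ℝ) ≤ 100 * k * (B + 1) := by
  have h1 := h.card_mul_le
  have hm' : (0 : ℝ) < m := by exact_mod_cast hm
  refine le_of_mul_le_mul_left (h1.trans ?_) hm'
  rw [mul_comm (m : ℝ)]
  gcongr
  linarith [Nat.cast_nonneg (α := ℝ) (nonCovered S κ).card]

theorem hinge_nonneg (s : ℝ) (y : ℤˣ) : 0 ≤ hinge s y := le_max_left _ _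

/-- The loss of the realizing vector on the examples that GreedyRule leaves uncovered. -/
theorem hingeSum_le_of_realizes (hB : 1 ≤ B) {κ κ₀ : Finset (Fin d)}
    {w : EuclideanSpace ℝ (Fin d)} (hw : ‖w‖ ≤ B) (hκ₀ : κ₀.card ≤ k)
    (hrule : ∀ i, (∃ j ∈ κ₀, 0 < (S i).1 j) → (S i).2 = 1)
    (hlin : ∀ i, (∀ j ∈ κ₀, (S i).1 j ≤ 0) → 1 ≤ labelVal (S i).2 * inner ℝ w (S i).1)
    (hball : ∀ i, ‖(S i).1‖ ≤ 1) (hmaximal : ∀ j, ¬ CanAdd k B S κ j) :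
    hingeSum S κ w ≤ m / 100 := by
  classical
  have h1 : ∀ i, hinge (inner ℝ w (S i).1) (S i).2 ≤
      -- An example met by a realizing rule has loss at most `1 + B` and is charged to the rules
      -- that meet it; any other example has margin at least `1` and loss `0`.
      (1 + B) * ∑ j ∈ κ₀, if 0 < (S i).1 j then (1 : ℝ) else 0 := by
    intro i
    by_cases h : ∃ j ∈ κ₀, 0 < (S i).1 j
    · obtain ⟨j, hj, hpos⟩ := h
      have h2 : (1 : ℝ) ≤ ∑ j ∈ κ₀, if 0 < (S i).1 j then (1 : ℝ) else 0 := by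
        refine le_trans (by simp [hpos]) (Finset.single_le_sum (f := fun j =>
          if 0 < (S i).1 j then (1 : ℝ) else 0) (fun j _ => by split_ifs <;> norm_num) hj)
      have h3 : |inner ℝ w (S i).1| ≤ B := by
        refine (abs_real_inner_le_norm _ _).trans ?_
        calc ‖w‖ * ‖(S i).1‖ ≤ B * 1 := by
              gcongr
              exact hball i
          _ = B := mul_one B
      have h4 : hinge (inner ℝ w (S i).1) (S i).2 ≤ 1 + B := by
        refine max_le (by linarith) ?_
        have h5 : |inner ℝ w (S i).1 * labelVal (S i).2| ≤ B := by
          rwa [abs_mul, abs_labelVal, mul_one]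
        linarith [(abs_le.1 h5).1]
      nlinarith
    · push Not at h
      have h2 := hlin i h
      rw [hinge, max_eq_left (by linarith [mul_comm (labelVal (S i).2) (inner ℝ w (S i).1)])]
      refine mul_nonneg (by linarith) (Finset.sum_nonneg fun j _ => ?_)
      split_ifs <;> norm_num
  have h2 : hingeSum S κ w ≤ (1 + B) * ∑ j ∈ κ₀,
      (((nonCovered S κ).filter fun i => 0 < (S i).1 j).card : ℝ) := by
    refine (Finset.sum_le_sum fun i _ => h1 i).trans ?_
    rw [← Finset.mul_sum, Finset.sum_comm]
    simp only [Finset.sum_boole, le_refl]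
  refine h2.trans ?_
  have h3 : ∀ j ∈ κ₀, 100 * k * (B + 1) *
      (((nonCovered S κ).filter fun i => 0 < (S i).1 j).card : ℝ) ≤ m := by
    intro j hj
    by_contra! h
    exact hmaximal j ⟨fun i hi => hrule i ⟨j, hj, hi⟩, by convert h⟩
  -- The threshold is about to be divided by `k`, which may be `0` only if `κ₀` is empty.
  rcases κ₀.eq_empty_or_nonempty with rfl | hne
  · simp only [Finset.sum_empty, mul_zero]
    positivity
  · have hk : (0 : ℝ) < k := by exact_mod_cast lt_of_lt_of_le hne.card_pos hκ₀
    have h4 := Finset.sum_le_sum h3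
    rw [← Finset.mul_sum, Finset.sum_const, nsmul_eq_mul] at h4
    have h5 : (κ₀.card : ℝ) * m ≤ k * m := by gcongr
    refine le_of_mul_le_mul_left ?_ (mul_pos (by norm_num : (0 : ℝ) < 100) hk)
    calc _ = _ := ?_
      _ ≤ _ := h4.trans h5
      _ = _ := ?_
    · ring
    · ring

/-- The examples on which the rules `κ` are wrong or `u` has margin at most `1 / 3`. -/
def marginBad (κ : Finset (Fin d)) (u : EuclideanSpace ℝ (Fin d)) : Set (LabelledExample d) :=
  {z | (∃ j ∈ κ, 0 < z.1 j) ∧ z.2 ≠ 1 ∨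
    (∀ j ∈ κ, ¬ 0 < z.1 j) ∧ labelVal z.2 * inner ℝ u z.1 ≤ 1 / 3}

theorem labelVal_mul_le {w u x : EuclideanSpace ℝ (Fin d)} {y : ℤˣ}
    (h : |inner ℝ (u - w) x| < 1 / 3) :
    |labelVal y * inner ℝ u x - labelVal y * inner ℝ w x| < 1 / 3 := by
  rwa [← mul_sub, ← inner_sub_left, abs_mul, abs_labelVal, one_mul]

/-- An error of the linear part means margin at most `0` for `w`, hence less than `1/3` for a close
`u`. Thus the error set lies in `marginBad`, up to points where the rounding is bad. -/
theorem mem_marginBad_of_ne {κ : Finset (Fin d)} {w u : EuclideanSpace ℝ (Fin d)}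
    {z : LabelledExample d} (hz : rulesFirst (κ, w) z.1 ≠ z.2)
    (h : |inner ℝ (u - w) z.1| < 1 / 3) : z ∈ marginBad κ u := by
  have h1 := (abs_lt.1 (labelVal_mul_le (y := z.2) h)).2
  by_cases hc : ∃ j ∈ κ, 0 < z.1 j
  · left
    simp only [rulesFirst, hc, if_true] at hz
    exact ⟨hc, hz.symm⟩
  · right
    simp only [rulesFirst, hc, if_false, sgn] at hz
    push Not at hc
    refine ⟨fun j hj => not_lt.2 (hc j hj), ?_⟩
    rcases Int.units_eq_one_or z.2 with hy | hy <;> rw [hy] at hz h1 ⊢ <;>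
      simp only [labelVal_one, labelVal_neg_one] at h1 ⊢ <;> split_ifs at hz with hpos
    · exact absurd rfl hz
    · linarith
    · linarith
    · exact absurd rfl hz

-- Rules make no mistake on the sample. A margin of at most `1/3` for a close `u` forces margin
-- below `2/3` for `w`, so hinge loss at least `1/3`; this happens at most `3m/100` times. With
-- `m/100` bad roundings the total is `m/25`.
open Classical in
theorem card_marginBad_le {κ : Finset (Fin d)} (hκ : ∀ j ∈ κ, IsRule S j)
    {w u : EuclideanSpace ℝ (Fin d)} (hw : hingeSum S κ w ≤ m / 100)
    (hu : ((Finset.univ.filter fun i => 1 / 3 ≤ |inner ℝ (u - w) (S i).1|).card : ℝ) ≤ m / 100) :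
    ((Finset.univ.filter fun i => S i ∈ marginBad κ u).card : ℝ) ≤ m / 25 := by
  have h1 : (((nonCovered S κ).filter fun i =>
      1 / 3 ≤ hinge (inner ℝ w (S i).1) (S i).2).card : ℝ) * (1 / 3) ≤ hingeSum S κ w := by
    rw [← nsmul_eq_mul]
    refine (Finset.card_nsmul_le_sum _ (fun i => hinge (inner ℝ w (S i).1) (S i).2) _
      fun i hi => (Finset.mem_filter.1 hi).2).trans ?_
    exact Finset.sum_le_sum_of_subset_of_nonneg (Finset.filter_subset _ _)
      fun i _ _ => hinge_nonneg _ _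
  have h2 : (Finset.univ.filter fun i => S i ∈ marginBad κ u) ⊆
      (Finset.univ.filter fun i => 1 / 3 ≤ |inner ℝ (u - w) (S i).1|) ∪
      ((nonCovered S κ).filter fun i => 1 / 3 ≤ hinge (inner ℝ w (S i).1) (S i).2) := by
    intro i hi
    simp only [Finset.mem_union, Finset.mem_filter, Finset.mem_univ, true_and, nonCovered] at hi ⊢
    rcases hi with ⟨⟨j, hj, hpos⟩, hy⟩ | ⟨hc, hle⟩
    · exact absurd (hκ j hj i hpos) hy
    · by_cases h : 1 / 3 ≤ |inner ℝ (u - w) (S i).1|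
      · exact Or.inl h
      · refine Or.inr ⟨hc, ?_⟩
        have h3 := (abs_lt.1 (labelVal_mul_le (y := (S i).2) (not_le.1 h))).1
        refine le_trans ?_ (le_max_right _ _)
        rw [mul_comm]
        linarith
  have h3 : ((Finset.univ.filter fun i => S i ∈ marginBad κ u).card : ℝ) ≤
      (Finset.univ.filter fun i => 1 / 3 ≤ |inner ℝ (u - w) (S i).1|).card +
      ((nonCovered S κ).filter fun i => 1 / 3 ≤ hinge (inner ℝ w (S i).1) (S i).2).card := by
    exact_mod_cast (Finset.card_le_card h2).trans (Finset.card_union_le _ _)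
  linarith

end greedy

/-! ### GreedyRule is a weak learner -/

section weak

variable {d : ℕ}

/-- The Laplace transform of the indicator of `A` at `-1`, for the Chernoff bound: `1 - 0.24 (1 -
1/e) ≤ 0.86 ≤ exp (-0.14)`. -/
theorem pexp_le_exp_of_le (D : PMF (LabelledExample d)) (A : Set (LabelledExample d))
    (hA : ENNReal.ofReal (24 / 100) ≤ D.toOuterMeasure A) :
    pexp D (fun z => ENNReal.ofReal (Real.exp (-1)) * A.indicator 1 z + Aᶜ.indicator 1 z) ≤
      ENNReal.ofReal (Real.exp (-(14 / 100))) := by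
  rw [pexp_add, pexp_const_mul]
  have h1 := toOuterMeasure_add_compl D A
  have h2 := toOuterMeasure_le_one D A
  have h3 := toOuterMeasure_le_one D Aᶜ
  change ENNReal.ofReal (Real.exp (-1)) * pexp D (A.indicator 1) + pexp D (Aᶜ.indicator 1) ≤ _
  rw [← toOuterMeasure_eq_pexp, ← toOuterMeasure_eq_pexp]
  lift D.toOuterMeasure A to NNReal using ne_top_of_le_ne_top ENNReal.one_ne_top h2 with a
  lift D.toOuterMeasure Aᶜ to NNReal using ne_top_of_le_ne_top ENNReal.one_ne_top h3 with b
  rw [← ENNReal.ofReal_coe_nnreal] at hA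
  have hA' := (ENNReal.ofReal_le_ofReal_iff a.2).1 hA
  have h1' : (a : ℝ) + b = 1 := by exact_mod_cast h1
  rw [← ENNReal.ofReal_coe_nnreal, ← ENNReal.ofReal_coe_nnreal,
    ← ENNReal.ofReal_mul (Real.exp_pos _).le, ← ENNReal.ofReal_add (by positivity)
      (NNReal.coe_nonneg b)]
  apply ENNReal.ofReal_le_ofReal
  have h4 : Real.exp (-1) ≤ 2 / 5 := by
    rw [Real.exp_neg, inv_le_comm₀ (Real.exp_pos _) (by norm_num)]
    linarith [Real.exp_one_gt_d9]
  have h5 := Real.add_one_le_exp (-(14 / 100) : ℝ)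
  have h6 : (24 / 100 : ℝ) * (3 / 5) ≤ a * (1 - Real.exp (-1)) :=
    mul_le_mul hA' (by linarith) (by norm_num) (NNReal.coe_nonneg a)
  linarith

open Classical in
/-- A Chernoff bound: a sample rarely meets a set of probability `0.24` with frequency at most
`0.04`. -/
theorem iidSample_card_le_le (D : PMF (LabelledExample d)) (A : Set (LabelledExample d))
    (hA : ENNReal.ofReal (24 / 100) ≤ D.toOuterMeasure A) (m : ℕ) :
    (iidSample D m).toOuterMeasure
      {S | ((Finset.univ.filter fun i => S i ∈ A).card : ℝ) ≤ m / 25} ≤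
      ENNReal.ofReal (Real.exp (-(m / 10))) := by
  have h1 := pexp_iidSample_prod_le D _ m ∅ (fun _ z => ENNReal.ofReal (Real.exp (-1)) *
    A.indicator 1 z + Aᶜ.indicator 1 z) (fun _ _ _ => rfl) (fun _ => pexp_le_exp_of_le D A hA)
  simp only [Finset.notMem_empty, if_false, Finset.card_empty, Nat.sub_zero] at h1
  calc _ ≤ pexp (iidSample D m) (fun S => ENNReal.ofReal (Real.exp (m / 25)) *
        ∏ i, (ENNReal.ofReal (Real.exp (-1)) * A.indicator 1 (S i) + Aᶜ.indicator 1 (S i))) := by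
        refine toOuterMeasure_le_pexp _ fun S _ hS => ?_
        have h2 : ∀ i, ENNReal.ofReal (Real.exp (-1)) * A.indicator 1 (S i) +
            Aᶜ.indicator 1 (S i) = ENNReal.ofReal (Real.exp (-(if S i ∈ A then 1 else 0))) := by
          intro i
          by_cases hi : S i ∈ A <;> simp [hi]
        simp only [h2]
        rw [← ENNReal.ofReal_prod_of_nonneg fun i _ => (Real.exp_pos _).le, ← Real.exp_sum,
          Finset.sum_neg_distrib, Finset.sum_boole, ← ENNReal.ofReal_mul (Real.exp_pos _).le,
          ← Real.exp_add, ← ENNReal.ofReal_one]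
        apply ENNReal.ofReal_le_ofReal
        rw [Real.one_le_exp_iff]
        simp only [Set.mem_ofPred_eq] at hS
        linarith
    _ ≤ ENNReal.ofReal (Real.exp (m / 25)) * ENNReal.ofReal (Real.exp (-(14 / 100))) ^ m := by
        rw [pexp_const_mul]
        gcongr
    _ = ENNReal.ofReal (Real.exp (m / 25 + m * (-(14 / 100)))) := by
        rw [← ENNReal.ofReal_pow (Real.exp_pos _).le, ← Real.exp_nat_mul,
          ← ENNReal.ofReal_mul (Real.exp_pos _).le, Real.exp_add]
    _ ≤ _ := by
        gcongr
        linarith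

theorem sum_choose_le (N K : ℕ) : ∑ i ∈ Finset.range (K + 1), N.choose i ≤ (N + 1) ^ K := by
  rw [add_pow]
  refine Finset.sum_le_sum fun i hi => ?_
  rw [one_pow, mul_one]
  refine (Nat.choose_le_pow N i).trans (Nat.le_mul_of_pos_right _ ?_)
  exact Nat.choose_pos (Nat.lt_succ_iff.1 (Finset.mem_range.1 hi))

theorem card_filter_card_le (α : Type*) [Fintype α] (K : ℕ) :
    (Finset.univ.filter fun κ : Finset α => κ.card ≤ K).card ≤ (Fintype.card α + 1) ^ K := by
  classical
  refine le_trans ?_ (sum_choose_le (Fintype.card α) K)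
  have h : (Finset.univ.filter fun κ : Finset α => κ.card ≤ K) ⊆
      (Finset.range (K + 1)).biUnion fun i => Finset.powersetCard i Finset.univ := by
    intro κ hκ
    simpa [Nat.lt_succ_iff] using hκ
  refine (Finset.card_le_card h).trans (Finset.card_biUnion_le.trans ?_)
  simp

end weak

end RulesFirst

namespace RulesFirst

open scoped ENNReal

/-! ### Union bound over rule sets, averaged over roundings -/

section weak

variable {d k : ℕ} {B : ℝ}

open Classical in
theorem card_le_of_uniform {m : ℕ} [Nonempty (Fin m)] (s : Set (Fin m)) {t : ℝ} (ht : 0 ≤ t)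
    (h : (PMF.uniformOfFintype (Fin m)).toOuterMeasure s ≤ ENNReal.ofReal t) :
    ((Finset.univ.filter fun i => i ∈ s).card : ℝ) ≤ t * m := by
  have hm : 0 < m := Fin.pos_iff_nonempty.2 inferInstance
  have hm' : (0 : ℝ) < m := by exact_mod_cast hm
  have h1 : (PMF.uniformOfFintype (Fin m)).toOuterMeasure s =
      ENNReal.ofReal ((Finset.univ.filter fun i => i ∈ s).card / m) := by
    rw [toOuterMeasure_eq_pexp, pexp_fintype]
    simp only [PMF.uniformOfFintype_apply, Fintype.card_fin, ← Finset.mul_sum,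
      Set.indicator_apply, Pi.one_apply, Finset.sum_boole]
    rw [ENNReal.ofReal_div_of_pos hm', ENNReal.ofReal_natCast, ENNReal.ofReal_natCast, mul_comm]
    rfl
  rw [h1, ENNReal.ofReal_le_ofReal_iff ht, div_le_iff₀ hm'] at h
  exact h

theorem IsRealizable.hingeSum_run_le (G : GreedyRule d k B) {D : PMF (LabelledExample d)}
    (hB : 1 ≤ B) (hD : IsRealizable k B D) (hball : InUnitBall D) {m : ℕ}
    (S : Fin m → LabelledExample d) (hS : ∀ i, S i ∈ D.support) :
    hingeSum S (G.run m S).1 (G.run m S).2 ≤ m / 100 := by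
  obtain ⟨κ₀, w₀, hcard, hw₀, hrule, hlin⟩ := hD
  obtain ⟨-, hmaximal, -, hmin⟩ := G.isGreedyOutput m S
  refine (hmin w₀ hw₀).trans (hingeSum_le_of_realizes hB ?_ hcard (fun i => hrule _ (hS i))
    (fun i => hlin _ (hS i)) (fun i => hball _ (hS i)) hmaximal)
  exact (sq_le_sq₀ (norm_nonneg _) (by linarith)).1 hw₀

/-- If GreedyRule fails on `S`, then for its set of rules a substantial fraction of all roundings
have small empirical loss and large true loss. -/
theorem exists_finset_of_err_gt (G : GreedyRule d k B) {D : PMF (LabelledExample d)}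
    (hB : 1 ≤ B) (hD : IsRealizable k B D) (hball : InUnitBall D) {m N : ℕ} (hm : 0 < m)
    (hN : 0 < N) (hNB : 60 * B ≤ √N) (S : Fin m → LabelledExample d)
    (hS : ∀ i, S i ∈ D.support) (herr : 1 / 4 < err D (G.hyp S)) :
    ∃ A : Finset (Fin d × Fin N → ℤˣ),
      Real.exp (-(3600 * B ^ 2)) / 4 * 2 ^ (d * N) ≤ (A.card : ℝ) ∧
      ∀ ω ∈ A, ENNReal.ofReal (24 / 100) ≤
          D.toOuterMeasure (marginBad (G.run m S).1 (roundVec ω)) ∧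
        S ∈ {S | ((@Finset.filter _ (fun i => S i ∈ marginBad (G.run m S).1 (roundVec ω))
          (fun _ => Classical.propDecidable _) Finset.univ).card : ℝ) ≤ m / 25} := by
  classical
  have : Nonempty (Fin m) := Fin.pos_iff_nonempty.1 hm
  obtain ⟨hreach, -, hw, -⟩ := G.isGreedyOutput m S
  have hw' : ‖(G.run m S).2‖ ≤ B := (sq_le_sq₀ (norm_nonneg _) (by linarith)).1 hw
  -- The second distribution is the empirical one, so the same roundings are good for the true loss
  -- and for the sample. On the true side, `1/4 - 1/100 = 24/100`.
  obtain ⟨A, hA, hA'⟩ := exists_finset_roundVec hN hNB hw' D (PMF.uniformOfFintype (Fin m))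
    Prod.fst hball (fun i => (S i).1) fun i _ => hball _ (hS i)
  refine ⟨A, hA, fun ω hω => ⟨?_, ?_⟩⟩
  · have h1 : ENNReal.ofReal (1 / 4) ≤ D.toOuterMeasure {z | G.hyp S z.1 ≠ z.2} :=
      (ENNReal.ofReal_le_iff_le_toReal (ne_top_of_le_ne_top ENNReal.one_ne_top
        (toOuterMeasure_le_one D _))).2 herr.le
    have h2 : D.toOuterMeasure {z | G.hyp S z.1 ≠ z.2} ≤
        D.toOuterMeasure (marginBad (G.run m S).1 (roundVec ω)) + ENNReal.ofReal (1 / 100) := by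
      refine le_trans ?_ (add_le_add le_rfl (hA' ω hω).1)
      refine le_trans (MeasureTheory.measure_mono ?_) (MeasureTheory.measure_union_le _ _)
      intro z hz
      by_cases h : 1 / 3 ≤ |inner ℝ (roundVec ω - (G.run m S).2) z.1|
      · exact Or.inr h
      · exact Or.inl (mem_marginBad_of_ne (w := (G.run m S).2) hz (not_le.1 h))
    have h3 : ENNReal.ofReal (24 / 100) = ENNReal.ofReal (1 / 4) - ENNReal.ofReal (1 / 100) := by
      rw [← ENNReal.ofReal_sub _ (by norm_num)]
      norm_num
    rw [h3]
    exact tsub_le_iff_right.2 (h1.trans h2)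
  · refine card_marginBad_le hreach.isRule (hD.hingeSum_run_le G hB hball S hS) ?_
    have h1 := card_le_of_uniform _ (by norm_num) (hA' ω hω).2
    refine le_trans (le_of_eq ?_) (h1.trans (by linarith))
    congr

/-- Double counting instead of a net: a failing sample lies in `bad κ ω` for at least `θ * 2 ^ (d *
N)` arrays `ω`, while the expected number of pairs whose `bad` set contains the sample is at most
`(d + 1)^K * 2 ^ (d * N) * exp (-m / 10)`. Dividing removes the dimension from the linear part. -/
theorem greedyRule_failure_le (G : GreedyRule d k B) {D : PMF (LabelledExample d)}
    (hB : 1 ≤ B) (hD : IsRealizable k B D) (hball : InUnitBall D) {m : ℕ} (hm : 0 < m) :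
    (iidSample D m).toOuterMeasure {S | 1 / 4 < err D (G.hyp S)} ≤
      ENNReal.ofReal (((d + 1 : ℕ) : ℝ) ^ ⌊100 * k * (B + 1)⌋₊ * Real.exp (-(m / 10)) *
        (4 * Real.exp (3600 * B ^ 2))) := by
  classical
  obtain ⟨N, hN⟩ := exists_nat_ge ((60 * B) ^ 2)
  have hNpos : 0 < N := by
    have : (0 : ℝ) < N := lt_of_lt_of_le (by positivity) hN
    exact_mod_cast this
  have hNB : 60 * B ≤ √N := Real.le_sqrt_of_sq_le hN
  set K := ⌊100 * k * (B + 1)⌋₊ with hK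
  let bad : Finset (Fin d) → (Fin d × Fin N → ℤˣ) → Set (Fin m → LabelledExample d) := fun κ ω =>
    {S | ENNReal.ofReal (24 / 100) ≤ D.toOuterMeasure (marginBad κ (roundVec ω)) ∧
      ((Finset.univ.filter fun i => S i ∈ marginBad κ (roundVec ω)).card : ℝ) ≤ m / 25}
  have hbad : ∀ κ ω, (iidSample D m).toOuterMeasure (bad κ ω) ≤
      ENNReal.ofReal (Real.exp (-(m / 10))) := by
    intro κ ω
    by_cases h : ENNReal.ofReal (24 / 100) ≤ D.toOuterMeasure (marginBad κ (roundVec ω))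
    · refine le_trans (MeasureTheory.measure_mono fun S hS => ?_) (iidSample_card_le_le D _ h m)
      refine le_trans (le_of_eq ?_) hS.2
      congr
    · have : bad κ ω = ∅ := Set.eq_empty_of_forall_notMem fun S hS => h hS.1
      rw [this]
      simp
  let F : Finset (Finset (Fin d)) := Finset.univ.filter fun κ => κ.card ≤ K
  have hF : (F.card : ℝ) ≤ ((d + 1 : ℕ) : ℝ) ^ K := by
    have := card_filter_card_le (Fin d) K
    rw [Fintype.card_fin] at this
    exact_mod_cast this
  have hcardΩ : ((Finset.univ : Finset (Fin d × Fin N → ℤˣ)).card : ℝ) = 2 ^ (d * N) := by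
    simp
  set θ : ℝ := Real.exp (-(3600 * B ^ 2)) / 4 with hθ
  have hθpos : 0 < θ := by positivity
  have key : ENNReal.ofReal (θ * 2 ^ (d * N)) *
      (iidSample D m).toOuterMeasure {S | 1 / 4 < err D (G.hyp S)} ≤
      ENNReal.ofReal (((d + 1 : ℕ) : ℝ) ^ K * 2 ^ (d * N) * Real.exp (-(m / 10))) := by
    calc _ = pexp (iidSample D m) (fun S => ENNReal.ofReal (θ * 2 ^ (d * N)) *
          {S | 1 / 4 < err D (G.hyp S)}.indicator 1 S) := by
          rw [pexp_const_mul, toOuterMeasure_eq_pexp]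
      _ ≤ pexp (iidSample D m) (fun S => ∑ κ ∈ F, ∑ ω, (bad κ ω).indicator 1 S) := by
          refine pexp_mono_support _ fun S hS => ?_
          by_cases herr : S ∈ {S : Fin m → LabelledExample d | 1 / 4 < err D (G.hyp S)}
          · have hS' := mem_support_of_mem_support_iidSample D m S hS
            obtain ⟨A, hA, hA'⟩ := exists_finset_of_err_gt G hB hD hball hm hNpos hNB S hS' herr
            have hκ : (G.run m S).1 ∈ F := by
              simp only [F, Finset.mem_filter, Finset.mem_univ, true_and, hK]
              exact Nat.le_floor ((G.isGreedyOutput m S).1.card_le hm hB)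
            calc _ = ENNReal.ofReal (θ * 2 ^ (d * N)) := by
                  rw [Set.indicator_of_mem herr, Pi.one_apply, mul_one]
              _ ≤ ENNReal.ofReal A.card := ENNReal.ofReal_le_ofReal hA
              _ = ∑ ω ∈ A, 1 := by simp
              _ ≤ ∑ ω ∈ A, (bad (G.run m S).1 ω).indicator 1 S := by
                  refine Finset.sum_le_sum fun ω hω => ?_
                  have : S ∈ bad (G.run m S).1 ω := by
                    refine ⟨(hA' ω hω).1, le_trans (le_of_eq ?_) (hA' ω hω).2⟩
                    congr
                  simp [this]
              _ ≤ ∑ ω, (bad (G.run m S).1 ω).indicator 1 S :=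
                  Finset.sum_le_sum_of_subset (Finset.subset_univ A)
              _ ≤ _ := Finset.single_le_sum (f := fun κ => ∑ ω, (bad κ ω).indicator 1 S)
                  (fun _ _ => zero_le) hκ
          · rw [Set.indicator_of_notMem herr, mul_zero]
            exact zero_le
      _ = ∑ κ ∈ F, ∑ ω, (iidSample D m).toOuterMeasure (bad κ ω) := by
          rw [pexp_finset_sum]
          refine Finset.sum_congr rfl fun κ _ => ?_
          rw [pexp_finset_sum]
          simp only [toOuterMeasure_eq_pexp]
      _ ≤ ∑ κ ∈ F, ∑ _ω : Fin d × Fin N → ℤˣ, ENNReal.ofReal (Real.exp (-(m / 10))) :=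
          Finset.sum_le_sum fun κ _ => Finset.sum_le_sum fun ω _ => hbad κ ω
      _ = ENNReal.ofReal (F.card * 2 ^ (d * N) * Real.exp (-(m / 10))) := by
          rw [Finset.sum_const, Finset.sum_const, nsmul_eq_mul, nsmul_eq_mul, ← mul_assoc,
            ENNReal.ofReal_mul (by positivity), ENNReal.ofReal_mul (by positivity), ← hcardΩ,
            ENNReal.ofReal_natCast, ENNReal.ofReal_natCast]
      _ ≤ _ := by
          apply ENNReal.ofReal_le_ofReal
          gcongr
  have hpos : (0 : ℝ) < θ * 2 ^ (d * N) := by positivity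
  rw [mul_comm, ← ENNReal.le_div_iff_mul_le (Or.inl (by simpa using hpos))
    (Or.inl ENNReal.ofReal_ne_top), ← ENNReal.ofReal_div_of_pos hpos] at key
  refine key.trans (le_of_eq ?_)
  congr 1
  rw [hθ]
  field_simp
  rw [← Real.exp_add, neg_add_cancel, Real.exp_zero]

theorem one_le_capacity (d k : ℕ) {B : ℝ} (hB : 1 ≤ B) : 1 ≤ capacity d k B := by
  have h1 : 0 ≤ Real.log ((d : ℝ) + 1) :=
    Real.log_nonneg (by linarith [Nat.cast_nonneg (α := ℝ) d])
  have h2 : 0 ≤ k * B * Real.log ((d : ℝ) + 1) := by positivity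
  unfold capacity
  nlinarith

theorem one_le_log_two_add {x : ℝ} (hx : 1 ≤ x) : 1 ≤ Real.log (2 + x) := by
  rw [Real.le_log_iff_exp_le (by linarith)]
  linarith [Real.exp_one_lt_d9]

/-- In logarithms, rule sets and rounding cost at most `3600 M`, and `log 4 + log (1/δ)` at most `3
M L`; the hypothesis gives `m / 10 ≥ 4000 M L`. -/
theorem greedyRule_weak (G : GreedyRule d k B) {D : PMF (LabelledExample d)}
    (hB : 1 ≤ B) (hD : IsRealizable k B D) (hball : InUnitBall D) {δ : ℝ} (hδ : 0 < δ)
    (hδ1 : δ ≤ 1) {m : ℕ}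
    (hm : 40000 * capacity d k B * Real.log (2 + capacity d k B / δ) ≤ m) :
    (iidSample D m).toOuterMeasure {S | 1 / 4 < err D (G.hyp S)} ≤ ENNReal.ofReal δ := by
  set M := capacity d k B with hM
  set L := Real.log (2 + M / δ) with hL
  have hM1 : 1 ≤ M := one_le_capacity d k hB
  have hMδ : 1 / δ ≤ M / δ := by gcongr
  have h1δ : 1 ≤ 1 / δ := (one_le_div hδ).2 hδ1
  have hL1 : 1 ≤ L := one_le_log_two_add (h1δ.trans hMδ)
  have hLδ : Real.log (1 / δ) ≤ L := Real.log_le_log (by positivity) (by linarith)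
  have hm0 : (0 : ℝ) < m := lt_of_lt_of_le (by positivity) hm
  refine (greedyRule_failure_le G hB hD hball (by exact_mod_cast hm0)).trans
    (ENNReal.ofReal_le_ofReal ?_)
  have hlogd : 0 ≤ Real.log ((d : ℝ) + 1) :=
    Real.log_nonneg (by linarith [Nat.cast_nonneg (α := ℝ) d])
  have hfl : (⌊100 * k * (B + 1)⌋₊ : ℝ) ≤ 200 * (k * B) := by
    refine (Nat.floor_le (by positivity)).trans ?_
    nlinarith [Nat.cast_nonneg (α := ℝ) k]
  have hlog4 : Real.log 4 ≤ 2 := by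
    rw [Real.log_le_iff_le_exp (by norm_num)]
    have h := Real.add_one_le_exp (1 : ℝ)
    have : Real.exp 2 = Real.exp 1 * Real.exp 1 := by rw [← Real.exp_add]; norm_num
    nlinarith
  have e1 : (((d + 1 : ℕ) : ℝ)) ^ ⌊100 * k * (B + 1)⌋₊ =
      Real.exp (⌊100 * k * (B + 1)⌋₊ * Real.log ((d : ℝ) + 1)) := by
    rw [Real.exp_nat_mul, Real.exp_log (by positivity)]
    push_cast
    rfl
  have e2 : (4 : ℝ) = Real.exp (Real.log 4) := (Real.exp_log (by norm_num)).symm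
  have e3 : δ = Real.exp (-Real.log (1 / δ)) := by
    rw [one_div, Real.log_inv, neg_neg, Real.exp_log hδ]
  rw [e1]
  conv_lhs => rw [e2]
  conv_rhs => rw [e3]
  rw [← Real.exp_add, ← Real.exp_add, ← Real.exp_add]
  apply Real.exp_le_exp.2
  have h1 : (⌊100 * k * (B + 1)⌋₊ : ℝ) * Real.log ((d : ℝ) + 1) + 3600 * B ^ 2 ≤ 3600 * M := by
    have := mul_le_mul_of_nonneg_right hfl hlogd
    have h0 : 0 ≤ k * B * Real.log ((d : ℝ) + 1) := by positivity
    rw [hM, capacity]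
    nlinarith
  have h2 : M ≤ M * L := le_mul_of_one_le_right (by linarith) hL1
  have h3 : L ≤ M * L := le_mul_of_one_le_left (by linarith) hM1
  linarith

end weak

end RulesFirst

namespace RulesFirst

open scoped ENNReal

/-! ### AdaBoost -/

section adaBoost

variable {d k n : ℕ} {B : ℝ}

/-- The exponential loss of the vote `F` on the sample `S`. -/
noncomputable def expLoss (S : Fin n → LabelledExample d) (F : EuclideanSpace ℝ (Fin d) → ℝ) : ℝ :=
  ∑ i, Real.exp (-(labelVal (S i).2 * F (S i).1))

theorem expLoss_pos (hn : 0 < n) (S : Fin n → LabelledExample d)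
    (F : EuclideanSpace ℝ (Fin d) → ℝ) : 0 < expLoss S F :=
  Finset.sum_pos (fun _ _ => Real.exp_pos _) ⟨⟨0, hn⟩, Finset.mem_univ _⟩

theorem boostDist_toReal (hn : 0 < n) (S : Fin n → LabelledExample d)
    (F : EuclideanSpace ℝ (Fin d) → ℝ) (i : Fin n) :
    (boostDist hn S F i).toReal = Real.exp (-(labelVal (S i).2 * F (S i).1)) / expLoss S F := by
  rw [boostDist, PMF.normalize_apply, tsum_fintype,
    ← ENNReal.ofReal_sum_of_nonneg fun _ _ => (Real.exp_pos _).le, ENNReal.toReal_mul,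
    ENNReal.toReal_inv, ENNReal.toReal_ofReal (Real.exp_pos _).le, ENNReal.toReal_ofReal
      (Finset.sum_nonneg fun _ _ => (Real.exp_pos _).le), div_eq_mul_inv]
  rfl

theorem boostErr_eq (hn : 0 < n) (S : Fin n → LabelledExample d)
    (F : EuclideanSpace ℝ (Fin d) → ℝ) (h : Classifier d) :
    boostErr hn S F h * expLoss S F =
      ∑ i, if h (S i).1 = (S i).2 then 0 else Real.exp (-(labelVal (S i).2 * F (S i).1)) := by
  rw [boostErr, Finset.sum_mul]
  refine Finset.sum_congr rfl fun i _ => ?_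
  rw [boostDist_toReal, ite_mul, zero_mul, div_mul_cancel₀ _ (expLoss_pos hn S F).ne']

theorem boostErr_nonneg (hn : 0 < n) (S : Fin n → LabelledExample d)
    (F : EuclideanSpace ℝ (Fin d) → ℝ) (h : Classifier d) : 0 ≤ boostErr hn S F h :=
  Finset.sum_nonneg fun i _ => by split_ifs <;> simp

theorem eq_of_boostErr_eq_zero (hn : 0 < n) (S : Fin n → LabelledExample d)
    (F : EuclideanSpace ℝ (Fin d) → ℝ) (h : Classifier d) (h0 : boostErr hn S F h = 0)
    (i : Fin n) : h (S i).1 = (S i).2 := by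
  by_contra hne
  have h1 := (Finset.sum_eq_zero_iff_of_nonneg fun i _ => by split_ifs <;> simp).1 h0 i
    (Finset.mem_univ i)
  rw [if_neg hne, boostDist_toReal] at h1
  exact (div_pos (Real.exp_pos _) (expLoss_pos hn S F)).ne' h1

theorem expLoss_add (hn : 0 < n) (S : Fin n → LabelledExample d)
    (F : EuclideanSpace ℝ (Fin d) → ℝ) (h : Classifier d) (α : ℝ) :
    expLoss S (fun x => F x + α * labelVal (h x)) =
      ((1 - boostErr hn S F h) * Real.exp (-α) + boostErr hn S F h * Real.exp α) *
        expLoss S F := by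
  have h1 : ∀ i, Real.exp (-(labelVal (S i).2 * (F (S i).1 + α * labelVal (h (S i).1)))) =
      Real.exp (-α) * Real.exp (-(labelVal (S i).2 * F (S i).1)) +
      (Real.exp α - Real.exp (-α)) * (if h (S i).1 = (S i).2 then 0 else
        Real.exp (-(labelVal (S i).2 * F (S i).1))) := by
    intro i
    have h2 : Real.exp (-(labelVal (S i).2 * (F (S i).1 + α * labelVal (h (S i).1)))) =
        Real.exp (-(labelVal (S i).2 * labelVal (h (S i).1) * α)) *
        Real.exp (-(labelVal (S i).2 * F (S i).1)) := by
      rw [← Real.exp_add]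
      ring_nf
    rw [h2]
    rcases Int.units_eq_one_or (S i).2 with hy | hy <;>
      rcases Int.units_eq_one_or (h (S i).1) with hh | hh <;> rw [hy, hh] <;>
      simp [labelVal_one, labelVal_neg_one] <;> ring
  have h3 := boostErr_eq hn S F h
  rw [add_mul, mul_right_comm, mul_right_comm (boostErr hn S F h), sub_mul, h3, one_mul]
  simp only [expLoss, h1, Finset.sum_add_distrib, ← Finset.mul_sum]
  ring

/-- With AdaBoost's weight the factor is `2 √(e (1 - e))`, at most `√3 / 2 < 7/8` for `e ≤ 1/4`. -/
theorem expLoss_step_le (hn : 0 < n) (S : Fin n → LabelledExample d)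
    (F : EuclideanSpace ℝ (Fin d) → ℝ) (h : Classifier d) (h0 : boostErr hn S F h ≠ 0)
    (h1 : boostErr hn S F h ≤ 1 / 4) :
    expLoss S (fun x => F x + 1 / 2 * Real.log ((1 - boostErr hn S F h) / boostErr hn S F h) *
      labelVal (h x)) ≤ 7 / 8 * expLoss S F := by
  rw [expLoss_add hn]
  have hpos := lt_of_le_of_ne (boostErr_nonneg hn S F h) h0.symm
  set e := boostErr hn S F h
  refine mul_le_mul_of_nonneg_right ?_ (expLoss_pos hn S F).le
  have hq : 0 < (1 - e) / e := div_pos (by linarith) hpos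
  set a := Real.exp (1 / 2 * Real.log ((1 - e) / e)) with ha
  have ha0 : 0 < a := Real.exp_pos _
  have ha2 : a * a = (1 - e) / e := by
    rw [ha, ← Real.exp_add, ← add_mul, add_halves, one_mul, Real.exp_log hq]
  have hea : e * a * a = 1 - e := by
    rw [mul_assoc, ha2, mul_div_cancel₀ _ h0]
  have h2 : (1 - e) * Real.exp (-(1 / 2 * Real.log ((1 - e) / e))) = e * a := by
    rw [Real.exp_neg, ← ha, ← hea, mul_assoc _ a, mul_inv_cancel₀ ha0.ne', mul_one]
  rw [h2]
  have h3 : (2 * (e * a)) ^ 2 ≤ (7 / 8) ^ 2 := by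
    have : (2 * (e * a)) ^ 2 = 4 * e * (e * a * a) := by ring
    rw [this, hea]
    nlinarith
  have := abs_le_of_sq_le_sq' h3 (by norm_num)
  linarith [this.2]

theorem err_boostDist_map (hn : 0 < n) (S : Fin n → LabelledExample d)
    (F : EuclideanSpace ℝ (Fin d) → ℝ) (h : Classifier d) :
    err ((boostDist hn S F).map S) h = boostErr hn S F h := by
  rw [err, PMF.toOuterMeasure_map_apply, PMF.toOuterMeasure_apply_fintype, ENNReal.toReal_sum]
  · refine Finset.sum_congr rfl fun i _ => ?_
    by_cases hi : h (S i).1 = (S i).2 <;> simp [hi]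
  · intro i _
    by_cases hi : h (S i).1 = (S i).2 <;> simp [hi, PMF.apply_ne_top]

/-- The AdaBoost distribution, pushed forward to examples, is supported in the support of `D`. Hence
it is realizable by the same rules and vector, and the weak learner applies to it. -/
theorem boostErr_failure_le (G : GreedyRule d k B) {D : PMF (LabelledExample d)}
    (hB : 1 ≤ B) (hD : IsRealizable k B D) (hball : InUnitBall D) {δ : ℝ} (hδ : 0 < δ)
    (hδ1 : δ ≤ 1) {r : ℕ}
    (hr : 40000 * capacity d k B * Real.log (2 + capacity d k B / δ) ≤ r)
    (hn : 0 < n) (S : Fin n → LabelledExample d) (hS : ∀ i, S i ∈ D.support)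
    (F : EuclideanSpace ℝ (Fin d) → ℝ) :
    (iidSample (boostDist hn S F) r).toOuterMeasure
      {I | 1 / 4 < boostErr hn S F (G.hyp fun a => S (I a))} ≤ ENNReal.ofReal δ := by
  have hsupp : ∀ z ∈ ((boostDist hn S F).map S).support, z ∈ D.support := by
    intro z hz
    obtain ⟨i, -, rfl⟩ := (PMF.mem_support_map_iff _ _ _).1 hz
    exact hS i
  have hD' : IsRealizable k B ((boostDist hn S F).map S) := by
    obtain ⟨κ, w, h1, h2, h3, h4⟩ := hD
    exact ⟨κ, w, h1, h2, fun z hz => h3 z (hsupp z hz), fun z hz => h4 z (hsupp z hz)⟩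
  have key := greedyRule_weak G hB hD' (fun z hz => hball z (hsupp z hz)) hδ hδ1 hr
  rw [iidSample_map, PMF.toOuterMeasure_map_apply] at key
  simpa only [err_boostDist_map, Set.preimage_ofPred_eq] using key

/-- If the weak learner fails with probability at most `η` in each round, then the vote is correct
on the whole training sample except with probability `T * η`. -/
theorem adaBoost_failure_le (G : GreedyRule d k B) (r : ℕ) (hn : 0 < n)
    (S : Fin n → LabelledExample d) {η : ℝ≥0∞}
    (hη : ∀ F, (iidSample (boostDist hn S F) r).toOuterMeasure
      {I | 1 / 4 < boostErr hn S F (G.hyp fun a => S (I a))} ≤ η) :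
    ∀ (T : ℕ) (F : EuclideanSpace ℝ (Fin d) → ℝ), (7 / 8) ^ T * expLoss S F < 1 →
      (adaBoost G r hn S T F).toOuterMeasure {F' | ∃ i, sgn (F' (S i).1) ≠ (S i).2} ≤ T * η
  | 0, F, hF => by
    rw [adaBoost, toOuterMeasure_eq_pexp, pexp_pure, Set.indicator_of_notMem]
    · simp
    -- An exponential loss below `1` bounds every single term below `1`, which means `y F(x) > 0` on
    -- every example.
    · rintro ⟨i, hi⟩
      rw [pow_zero, one_mul] at hF
      have h1 : Real.exp (-(labelVal (S i).2 * F (S i).1)) < 1 :=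
        lt_of_le_of_lt (Finset.single_le_sum (f := fun i =>
          Real.exp (-(labelVal (S i).2 * F (S i).1))) (fun _ _ => (Real.exp_pos _).le)
          (Finset.mem_univ i)) hF
      rw [Real.exp_lt_one_iff] at h1
      rcases Int.units_eq_one_or (S i).2 with hy | hy <;> rw [hy] at h1 hi <;>
        simp only [labelVal_one, labelVal_neg_one, sgn] at h1 hi <;> split_ifs at hi with hpos
      · exact hi rfl
      · linarith
      · linarith
      · exact hi rfl
  | T + 1, F, hF => by
    rw [adaBoost, toOuterMeasure_eq_pexp, pexp_bind]
    have hcast : ((T + 1 : ℕ) : ℝ≥0∞) * η = η + T * η := by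
      push_cast
      ring
    rw [hcast]
    refine le_trans (b := pexp (iidSample (boostDist hn S F) r) fun I =>
      {I : Fin r → Fin n | 1 / 4 < boostErr hn S F (G.hyp fun a => S (I a))}.indicator 1 I +
        T * η) (pexp_mono _ fun I => ?_) ?_
    · rw [← toOuterMeasure_eq_pexp]
      by_cases hI : I ∈ {I : Fin r → Fin n |
        1 / 4 < boostErr hn S F (G.hyp fun a => S (I a))}
      · rw [Set.indicator_of_mem hI, Pi.one_apply]
        exact (toOuterMeasure_le_one _ _).trans le_self_add
      · rw [Set.indicator_of_notMem hI, zero_add]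
        have hI' : boostErr hn S F (G.hyp fun a => S (I a)) ≤ 1 / 4 := not_lt.1 hI
        dsimp only
        split_ifs with h0 h1
        · rw [toOuterMeasure_eq_pexp, pexp_pure, Set.indicator_of_notMem]
          · exact zero_le
          · rintro ⟨i, hi⟩
            dsimp only at hi
            rw [eq_of_boostErr_eq_zero hn S F _ h0 i] at hi
            refine hi ?_
            rcases Int.units_eq_one_or (S i).2 with hy | hy <;> rw [hy] <;>
              simp [sgn, labelVal]
        · linarith
        · refine adaBoost_failure_le G r hn S hη T _ (lt_of_le_of_lt ?_ hF)
          rw [pow_succ, mul_assoc]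
          exact mul_le_mul_of_nonneg_left (expLoss_step_le hn S F _ h0 hI') (by positivity)
    · rw [pexp_add, pexp_const, ← toOuterMeasure_eq_pexp]
      gcongr
      exact hη F

/-- `F` is a weighted vote of `T` hypotheses that GreedyRule returns on `r` examples of `S`. -/
def IsVote (G : GreedyRule d k B) (r : ℕ) (S : Fin n → LabelledExample d) (T : ℕ)
    (F : EuclideanSpace ℝ (Fin d) → ℝ) : Prop :=
  ∃ (I : Fin T → Fin r → Fin n) (α : Fin T → ℝ),
    F = fun x => ∑ t, α t * labelVal (G.hyp (fun a => S (I t a)) x)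

theorem isVote_zero (G : GreedyRule d k B) (r : ℕ) (S : Fin n → LabelledExample d) :
    IsVote G r S 0 fun _ => 0 :=
  ⟨Fin.elim0, Fin.elim0, by simp⟩

theorem IsVote.add {G : GreedyRule d k B} {r : ℕ} {S : Fin n → LabelledExample d} {T : ℕ}
    {F : EuclideanSpace ℝ (Fin d) → ℝ} (hF : IsVote G r S T F) (I : Fin r → Fin n) (a : ℝ) :
    IsVote G r S (T + 1) fun x => F x + a * labelVal (G.hyp (fun b => S (I b)) x) := by
  obtain ⟨J, α, rfl⟩ := hF
  refine ⟨Fin.cons I J, Fin.cons a α, ?_⟩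
  funext x
  simp [Fin.sum_univ_succ, add_comm]

theorem IsVote.mono (hn : 0 < n) {G : GreedyRule d k B} {r : ℕ} {S : Fin n → LabelledExample d}
    {T T' : ℕ} {F : EuclideanSpace ℝ (Fin d) → ℝ} (hF : IsVote G r S T F) (h : T ≤ T') :
    IsVote G r S T' F := by
  induction h with
  | refl => exact hF
  | step _ ih => simpa using ih.add (fun _ => ⟨0, hn⟩) 0

/-- Runs that stop early are padded with zero weights to a common length, so that a single
compression scheme covers all outputs. -/
theorem isVote_of_mem_support_adaBoost (G : GreedyRule d k B) (r : ℕ) (hn : 0 < n)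
    (S : Fin n → LabelledExample d) :
    ∀ (T j : ℕ) (F F' : EuclideanSpace ℝ (Fin d) → ℝ), IsVote G r S j F →
      F' ∈ (adaBoost G r hn S T F).support → IsVote G r S (j + T) F'
  | 0, j, F, F', hF, hF' => by
    rw [adaBoost, PMF.support_pure, Set.mem_singleton_iff] at hF'
    rwa [hF']
  | T + 1, j, F, F', hF, hF' => by
    rw [adaBoost, PMF.mem_support_bind_iff] at hF'
    obtain ⟨I, -, hI⟩ := hF'
    dsimp only at hI
    split_ifs at hI with h0 h1
    · rw [PMF.support_pure, Set.mem_singleton_iff] at hI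
      -- A perfect hypothesis returned on its own is a vote of one voter with weight `1`.
      have h2 := (isVote_zero G r S).add I 1
      simp only [zero_add, one_mul] at h2
      rw [hI]
      exact h2.mono hn (by lia)
    · rw [PMF.support_pure, Set.mem_singleton_iff] at hI
      rw [hI]
      exact hF.mono hn (by lia)
    · have h2 := isVote_of_mem_support_adaBoost G r hn S T (j + 1) _ F' (hF.add I _) hI
      rwa [add_right_comm, add_assoc] at h2

end adaBoost

end RulesFirst

namespace RulesFirst

open scoped ENNReal

/-! ### The number of weighted votes -/

section votes

/-- The sets of sign patterns on which a weighted vote of `T` voters is positive. -/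
noncomputable def voteSets (T : ℕ) : Finset (Finset (Fin T → ℤˣ)) :=
  open Classical in
  Finset.univ.filter fun A => ∃ α : Fin T → ℝ, ∀ p, p ∈ A ↔ 0 < ∑ t, α t * labelVal (p t)

/-- More than `T` sign patterns are linearly dependent in `ℝ^T`. A vote that is positive exactly
where the coefficients `g` are positive makes `∑ g(q) ⟨α, q⟩ = 0` a sum of nonnegative terms, so `g`
has no positive entry; the same holds for `-g`. -/
theorem card_le_of_voteSets_shatters {T : ℕ} {s : Finset (Fin T → ℤˣ)}
    (hs : (voteSets T).Shatters s) : s.card ≤ T := by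
  classical
  by_contra! hlt
  have hdep : ¬ LinearIndependent ℝ fun (p : s) (t : Fin T) => labelVal (p.1 t) := by
    intro h
    have := h.fintype_card_le_finrank
    simp only [Fintype.card_coe, Module.finrank_fintype_fun_eq_card, Fintype.card_fin] at this
    lia
  obtain ⟨g, hg, i, hi⟩ := Fintype.not_linearIndependent_iff.1 hdep
  have key : ∀ g : s → ℝ, (∑ p : s, g p • fun t => labelVal (p.1 t)) = 0 → ∀ p, g p ≤ 0 := by
    intro g hg p
    by_contra! hpos
    obtain ⟨A, hA, hsA⟩ := hs (t := (Finset.univ.filter fun p : s => 0 < g p).map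
      (Function.Embedding.subtype _)) (by
        intro q hq
        obtain ⟨q', -, rfl⟩ := Finset.mem_map.1 hq
        exact q'.2)
    obtain ⟨α, hα⟩ := (Finset.mem_filter.1 hA).2
    have hiff : ∀ q : s, 0 < ∑ t, α t * labelVal (q.1 t) ↔ 0 < g q := by
      intro q
      rw [← hα, ← Finset.mem_inter.trans (and_iff_right q.2), hsA]
      simp
    have hsum : ∑ q : s, g q * ∑ t, α t * labelVal (q.1 t) = 0 := by
      have h1 : ∀ t, ∑ q : s, g q * labelVal (q.1 t) = 0 := fun t => by
        simpa using congrFun hg t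
      simp only [Finset.mul_sum]
      rw [Finset.sum_comm]
      refine Finset.sum_eq_zero fun t _ => ?_
      have h2 : ∀ q : s, g q * (α t * labelVal (q.1 t)) = α t * (g q * labelVal (q.1 t)) :=
        fun q => by ring
      simp only [h2]
      rw [← Finset.mul_sum, h1, mul_zero]
    have hnn : ∀ q ∈ Finset.univ, 0 ≤ g q * ∑ t, α t * labelVal (q.1 t) := by
      intro q _
      by_cases hq : 0 < g q
      · exact (mul_pos hq ((hiff q).2 hq)).le
      · exact mul_nonneg_of_nonpos_of_nonpos (not_lt.1 hq)
          (not_lt.1 fun h => hq ((hiff q).1 h))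
    have h3 := (Finset.sum_eq_zero_iff_of_nonneg hnn).1 hsum p (Finset.mem_univ p)
    exact (mul_pos hpos ((hiff p).2 hpos)).ne' h3
  have h1 := key g hg i
  have h2 := key (fun p => -g p) (by simpa using hg) i
  exact hi (by linarith)

/-- Sauer–Shelah in Pajor's form: a family has at most as many members as it shatters sets, and
these have at most `T` of the `2^T` points. -/
theorem card_voteSets_le (T : ℕ) : (voteSets T).card ≤ (2 ^ T + 1) ^ T := by
  refine (Finset.card_le_card_shatterer _).trans (le_trans (Finset.card_le_card ?_)
    ((card_filter_card_le (Fin T → ℤˣ) T).trans (by simp)))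
  intro s hs
  exact Finset.mem_filter.2 ⟨Finset.mem_univ s,
    card_le_of_voteSets_shatters (Finset.mem_shatterer.1 hs)⟩

end votes

/-! ### Generalization of sample compression -/

section compression

variable {d k n : ℕ} {B : ℝ}

/-- A classifier that is determined by few examples and is consistent with all the examples has
small error. -/
theorem compression_failure_le (D : PMF (LabelledExample d)) {Θ : Type*} [Fintype Θ] {q : ℕ}
    (J : Θ → Finset (Fin n)) (hq : ∀ θ, (J θ).card ≤ q)
    (h : Θ → (Fin n → LabelledExample d) → Classifier d)
    (hJ : ∀ θ S S', (∀ i ∈ J θ, S i = S' i) → h θ S = h θ S') {ε : ℝ} (hε : 0 ≤ ε) :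
    (iidSample D n).toOuterMeasure
      {S | ∃ θ, (∀ i, h θ S (S i).1 = (S i).2) ∧ ε < err D (h θ S)} ≤
      Fintype.card Θ * ENNReal.ofReal (1 - ε) ^ (n - q) := by
  classical
  let f : Θ → (Fin n → LabelledExample d) → LabelledExample d → ℝ≥0∞ := fun θ S z =>
    if ε < err D (h θ S) ∧ h θ S z.1 = z.2 then 1 else 0
  have hf : ∀ θ S, pexp D (f θ S) ≤ ENNReal.ofReal (1 - ε) := by
    intro θ S
    by_cases he : ε < err D (h θ S)
    · have h1 : ENNReal.ofReal ε ≤ D.toOuterMeasure {z | h θ S z.1 ≠ z.2} :=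
        (ENNReal.ofReal_le_iff_le_toReal (ne_top_of_le_ne_top ENNReal.one_ne_top
          (toOuterMeasure_le_one D _))).2 he.le
      have h2 := toOuterMeasure_add_compl D {z | h θ S z.1 ≠ z.2}
      have h3 : pexp D (f θ S) ≤ D.toOuterMeasure {z | h θ S z.1 ≠ z.2}ᶜ := by
        rw [toOuterMeasure_eq_pexp]
        refine pexp_mono _ fun z => ?_
        by_cases hz : h θ S z.1 = z.2 <;> simp [f, hz, he]
      rw [ENNReal.ofReal_sub _ hε, ENNReal.ofReal_one, ← h2]
      refine h3.trans (ENNReal.le_sub_of_add_le_left ENNReal.ofReal_ne_top ?_)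
      gcongr
    · have : f θ S = fun _ => 0 := by
        funext z
        simp [f, he]
      rw [this, pexp_const]
      exact zero_le
  have hρ : ENNReal.ofReal (1 - ε) ≤ 1 := by
    rw [← ENNReal.ofReal_one]
    exact ENNReal.ofReal_le_ofReal (by linarith)
  -- For a consistent `θ` of large error the product equals `1`. Given the examples in `J θ`, the
  -- remaining ones are fresh and each agrees with probability at most `1 - ε`.
  calc _ ≤ pexp (iidSample D n) (fun S => ∑ θ, ∏ i, if i ∈ J θ then 1 else f θ S (S i)) := by
        refine toOuterMeasure_le_pexp _ fun S _ hS => ?_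
        obtain ⟨θ, hcons, herr⟩ := hS
        refine le_trans ?_ (Finset.single_le_sum (f := fun θ => ∏ i, if i ∈ J θ then 1 else
          f θ S (S i)) (fun _ _ => zero_le) (Finset.mem_univ θ))
        refine le_of_eq (Finset.prod_eq_one fun i _ => ?_).symm
        simp [f, herr, hcons i]
    _ = ∑ θ, pexp (iidSample D n) (fun S => ∏ i, if i ∈ J θ then 1 else f θ S (S i)) := by
        rw [pexp_finset_sum]
    _ ≤ ∑ _θ : Θ, ENNReal.ofReal (1 - ε) ^ (n - q) := by
        refine Finset.sum_le_sum fun θ _ => ?_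
        refine (pexp_iidSample_prod_le D _ n (J θ) (f θ) (fun S S' hSS' => ?_) (hf θ)).trans ?_
        · simp only [f, hJ θ S S' hSS']
        · exact pow_le_pow_right_of_le_one' hρ (Nat.sub_le_sub_left (hq θ) n)
    _ = _ := by
        rw [Finset.sum_const, Finset.card_univ, nsmul_eq_mul]

/-- The voting weights are real and may depend on the whole sample, but the sign of the vote sees
them only through a member of `voteSets T`. Indices and this set form a finite compression code. -/
theorem vote_failure_le (G : GreedyRule d k B) (D : PMF (LabelledExample d)) (T r : ℕ) {ε : ℝ}
    (hε : 0 ≤ ε) :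
    (iidSample D n).toOuterMeasure {S | ∃ F, IsVote G r S T F ∧
      (∀ i, sgn (F (S i).1) = (S i).2) ∧ ε < err D fun x => sgn (F x)} ≤
      ((n ^ (T * r) * (2 ^ T + 1) ^ T : ℕ) : ℝ≥0∞) * ENNReal.ofReal (1 - ε) ^ (n - T * r) := by
  classical
  let Θ := (Fin T → Fin r → Fin n) × voteSets T
  let J : Θ → Finset (Fin n) := fun θ =>
    Finset.univ.image fun a : Fin T × Fin r => θ.1 a.1 a.2
  let h : Θ → (Fin n → LabelledExample d) → Classifier d := fun θ S x =>
    if (fun t => G.hyp (fun a => S (θ.1 t a)) x) ∈ θ.2.1 then 1 else -1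
  have hq : ∀ θ, (J θ).card ≤ T * r := fun θ => by
    simpa using Finset.card_image_le (s := (Finset.univ : Finset (Fin T × Fin r)))
      (f := fun a => θ.1 a.1 a.2)
  have hJ : ∀ θ S S', (∀ i ∈ J θ, S i = S' i) → h θ S = h θ S' := by
    intro θ S S' hSS'
    have : ∀ t, (fun a => S (θ.1 t a)) = fun a => S' (θ.1 t a) := fun t => by
      funext a
      exact hSS' _ (Finset.mem_image.2 ⟨(t, a), Finset.mem_univ _, rfl⟩)
    simp only [h, this]
  have hcard : (Fintype.card Θ : ℝ≥0∞) ≤ ((n ^ (T * r) * (2 ^ T + 1) ^ T : ℕ) : ℝ≥0∞) := by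
    have h1 : Fintype.card Θ = n ^ (T * r) * (voteSets T).card := by
      simp [Θ, ← pow_mul, mul_comm]
    rw [h1]
    exact_mod_cast Nat.mul_le_mul_left _ (card_voteSets_le T)
  refine le_trans (MeasureTheory.measure_mono ?_) ((compression_failure_le D J hq h hJ hε).trans
    (mul_le_mul_left hcard _))
  rintro S ⟨F, ⟨I, α, rfl⟩, hcons, herr⟩
  let A : Finset (Fin T → ℤˣ) := Finset.univ.filter fun p => 0 < ∑ t, α t * labelVal (p t)
  have hA : A ∈ voteSets T := Finset.mem_filter.2 ⟨Finset.mem_univ _, α, fun p => by simp [A]⟩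
  have heq : h (I, ⟨A, hA⟩) S =
      fun x => sgn (∑ t, α t * labelVal (G.hyp (fun a => S (I t a)) x)) := by
    funext x
    simp [h, A, sgn]
  refine ⟨(I, ⟨A, hA⟩), ?_, ?_⟩
  · rw [heq]
    exact hcons
  · rw [heq]
    exact herr

end compression

/-! ### BoostRule -/

section boostRule

variable {d k n : ℕ} {B : ℝ}

theorem rampLoss_labelVal (D : PMF (LabelledExample d)) (h : Classifier d) :
    rampLoss D (fun x => labelVal (h x)) = err D h := by
  rw [rampLoss, err, PMF.toOuterMeasure_apply, ENNReal.tsum_toReal_eq]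
  · refine tsum_congr fun z => ?_
    rcases Int.units_eq_one_or z.2 with hy | hy <;>
      rcases Int.units_eq_one_or (h z.1) with hh | hh <;>
      simp [ramp, hy, hh, labelVal_one, labelVal_neg_one]
  · intro z
    by_cases hz : h z.1 ≠ z.2 <;> simp [hz, PMF.apply_ne_top]

/-- Either some consistent vote generalizes badly, an event of the sample alone, or the weak learner
fails in one of the `T` rounds. -/
theorem boostRule_failure_le (G : GreedyRule d k B) {D : PMF (LabelledExample d)}
    (hB : 1 ≤ B) (hD : IsRealizable k B D) (hball : InUnitBall D) {η : ℝ} (hη : 0 < η)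
    (hη1 : η ≤ 1) {T r : ℕ}
    (hr : 40000 * capacity d k B * Real.log (2 + capacity d k B / η) ≤ r)
    (hn : 0 < n) (hT : (7 / 8 : ℝ) ^ T * n < 1) {ε : ℝ} (hε : 0 ≤ ε) :
    ((iidSample D n).bind fun S => boostRule G T r S).toOuterMeasure {h | ε < err D h} ≤
      ((n ^ (T * r) * (2 ^ T + 1) ^ T : ℕ) : ℝ≥0∞) * ENNReal.ofReal (1 - ε) ^ (n - T * r) +
        T * ENNReal.ofReal η := by
  set E : Set (Fin n → LabelledExample d) := {S | ∃ F, IsVote G r S T F ∧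
      (∀ i, sgn (F (S i).1) = (S i).2) ∧ ε < err D fun x => sgn (F x)}
  rw [toOuterMeasure_eq_pexp, pexp_bind]
  simp only [← toOuterMeasure_eq_pexp]
  refine le_trans (b := pexp (iidSample D n) fun S => E.indicator 1 S + T * ENNReal.ofReal η)
    (pexp_mono_support _ fun S hS => ?_) ?_
  · by_cases hE : S ∈ E
    · rw [Set.indicator_of_mem hE, Pi.one_apply]
      exact (toOuterMeasure_le_one _ _).trans le_self_add
    · rw [Set.indicator_of_notMem hE, zero_add, boostRule, dif_pos hn,
        PMF.toOuterMeasure_map_apply]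
      have hS' := mem_support_of_mem_support_iidSample D n S hS
      refine le_trans (toOuterMeasure_mono_support _ fun F hF hFe => ?_)
        (adaBoost_failure_le G r hn S (boostErr_failure_le G hB hD hball hη hη1 hr hn S hS') T
          (fun _ => 0) (by simpa [expLoss] using hT))
      have hv := isVote_of_mem_support_adaBoost G r hn S T 0 _ F (isVote_zero G r S) hF
      rw [zero_add] at hv
      by_contra hcons
      refine hE ⟨F, hv, fun i => ?_, hFe⟩
      by_contra hi
      exact hcons ⟨i, hi⟩
  · rw [pexp_add, pexp_const, ← toOuterMeasure_eq_pexp]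
    gcongr
    exact vote_failure_le G D T r hε

end boostRule

end RulesFirst

namespace RulesFirst

open scoped ENNReal

/-! ### The choice of the parameters -/

section parameters

theorem log_pow_three_le {s : ℝ} (hs : 1 ≤ s) : Real.log s ^ 3 ≤ 216 * √s := by
  have h0 : 0 ≤ Real.log s := Real.log_nonneg hs
  have h1 : Real.log s ≤ 6 * s ^ (1 / 6 : ℝ) := by
    have := Real.log_le_rpow_div (x := s) (by linarith) (by norm_num : (0 : ℝ) < 1 / 6)
    linarith
  have h2 : (s ^ (1 / 6 : ℝ)) ^ 3 = √s := by
    rw [← Real.rpow_natCast, ← Real.rpow_mul (by linarith), Real.sqrt_eq_rpow]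
    norm_num
  calc Real.log s ^ 3 ≤ (6 * s ^ (1 / 6 : ℝ)) ^ 3 := by gcongr
    _ = 216 * √s := by rw [mul_pow, h2]; norm_num

/-- Inverts the sample-size condition, so that `n` dominates logarithms of itself. With `s = n / A`,
`log (n / δ) = log s + log (A / δ)`; the first cube is `O(√s)` and the second is controlled by the
hypothesis. -/
theorem log_pow_three_mul_le {A δ n : ℝ} (hA : 1 ≤ A) (hδ : 0 < δ) (hδ1 : δ < 1)
    (h : 10 ^ 20 * A * Real.log (2 + A / δ) ^ 3 ≤ n) :
    5000000 * A * Real.log (n / δ) ^ 3 ≤ n := by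
  have hA0 : 0 < A := by linarith
  have hAδ : 1 ≤ A / δ := (one_le_div hδ).2 (by linarith)
  have hL := one_le_log_two_add hAδ
  have hL2 : Real.log (A / δ) ≤ Real.log (2 + A / δ) :=
    Real.log_le_log (by linarith) (by linarith)
  set L := Real.log (2 + A / δ)
  have hL3 : 1 ≤ L ^ 3 := one_le_pow₀ hL
  set s := n / A with hs
  have hn : n = s * A := (div_mul_cancel₀ n hA0.ne').symm
  have hsL : 10 ^ 20 * L ^ 3 ≤ s := by
    rw [hs, le_div_iff₀ hA0]
    linarith
  have hs0 : (10 : ℝ) ^ 20 ≤ s := by nlinarith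
  have hs1 : 1 ≤ s := by linarith
  have hΛ : Real.log (n / δ) ≤ Real.log s + L := by
    rw [hn, mul_div_assoc, Real.log_mul (by linarith) (by linarith)]
    linarith
  have hnδ : 0 ≤ Real.log (n / δ) := by
    rw [hn, mul_div_assoc]
    exact Real.log_nonneg (by nlinarith)
  have hls : 0 ≤ Real.log s := Real.log_nonneg hs1
  have h1 := log_pow_three_le hs1
  have h2 : (10 : ℝ) ^ 10 ≤ √s := Real.le_sqrt_of_sq_le (by linarith)
  have h3 : √s * √s = s := Real.mul_self_sqrt (by linarith)
  have h4 : Real.log (n / δ) ^ 3 ≤ 4 * (Real.log s ^ 3 + L ^ 3) := by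
    calc Real.log (n / δ) ^ 3 ≤ (Real.log s + L) ^ 3 := by gcongr
      _ ≤ 4 * (Real.log s ^ 3 + L ^ 3) := by
        nlinarith [mul_nonneg (by linarith : 0 ≤ Real.log s + L) (sq_nonneg (Real.log s - L))]
  have h5 : 5000000 * Real.log (n / δ) ^ 3 ≤ s := by nlinarith
  calc 5000000 * A * Real.log (n / δ) ^ 3 = 5000000 * Real.log (n / δ) ^ 3 * A := by ring
    _ ≤ s * A := by gcongr
    _ = n := hn.symm

/-- The number of rounds of BoostRule on `n` examples. -/
def boostRounds (n : ℕ) : ℕ := 6 * (Nat.log 2 n + 1)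

/-- The number of examples that BoostRule draws in each round. -/
noncomputable def boostDraws (δ : ℝ) (d k : ℕ) (B : ℝ) (n : ℕ) : ℕ :=
  ⌈40000 * capacity d k B *
    Real.log (2 + capacity d k B / (δ / (2 * boostRounds n)))⌉₊

/-- The zero vote has exponential loss `n`. The factor `6` in `boostRounds` is there because
`(7/8)^6 ≤ 1/2`. -/
theorem boostRounds_pow_lt (n : ℕ) : (7 / 8 : ℝ) ^ boostRounds n * n < 1 := by
  have h1 : (n : ℝ) < 2 ^ (Nat.log 2 n + 1) := by
    exact_mod_cast Nat.lt_pow_succ_log_self (by norm_num) n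
  have h2 : (7 / 8 : ℝ) ^ boostRounds n ≤ (1 / 2) ^ (Nat.log 2 n + 1) := by
    rw [boostRounds, pow_mul]
    gcongr
    norm_num
  calc (7 / 8 : ℝ) ^ boostRounds n * n ≤ (1 / 2) ^ (Nat.log 2 n + 1) * n := by gcongr
    _ < (1 / 2) ^ (Nat.log 2 n + 1) * 2 ^ (Nat.log 2 n + 1) := by gcongr
    _ = 1 := by rw [← mul_pow]; norm_num

theorem boostRounds_le {n : ℕ} {δ : ℝ} (hδ : 0 < δ) (hδ1 : δ < 1) (hn : 3 ≤ n) :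
    (boostRounds n : ℝ) ≤ 15 * Real.log (n / δ) := by
  have hn' : (3 : ℝ) ≤ n := by exact_mod_cast hn
  have h1 : (n : ℝ) ≤ n / δ := le_div_self (by linarith) hδ hδ1.le
  have h2 : Real.log n ≤ Real.log (n / δ) := Real.log_le_log (by linarith) h1
  have h3 : 1 ≤ Real.log n := by
    rw [Real.le_log_iff_exp_le (by linarith)]
    linarith [Real.exp_one_lt_d9]
  have h4 : (Nat.log 2 n : ℝ) * Real.log 2 ≤ Real.log n := by
    rw [← Real.log_pow]
    refine Real.log_le_log (by positivity) ?_
    exact_mod_cast Nat.pow_log_le_self 2 (by lia)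
  have h5 := Real.log_two_gt_d9
  have h6 : (Nat.log 2 n : ℝ) ≤ 3 / 2 * Real.log n := by
    nlinarith [Nat.cast_nonneg (α := ℝ) (Nat.log 2 n)]
  rw [boostRounds]
  push_cast
  linarith

theorem boostDraws_le {δ : ℝ} {d k n : ℕ} {B : ℝ} (hB : 1 ≤ B) (hδ : 0 < δ) (hδ1 : δ < 1)
    (hn : 30 ≤ n) (hM : capacity d k B ≤ n) :
    (boostDraws δ d k B n : ℝ) ≤ 160001 * capacity d k B * Real.log (n / δ) := by
  have hT := boostRounds_le hδ hδ1 (by lia : 3 ≤ n)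
  have hM1 := one_le_capacity d k hB
  have hn' : (30 : ℝ) ≤ n := by exact_mod_cast hn
  rw [boostDraws]
  set M := capacity d k B
  set x : ℝ := n / δ with hx
  have hnx : (n : ℝ) ≤ x := le_div_self (by linarith) hδ hδ1.le
  have hΛ1 : 1 ≤ Real.log x := by
    rw [Real.le_log_iff_exp_le (by linarith)]
    linarith [Real.exp_one_lt_d9]
  have hΛx : Real.log x ≤ x := by linarith [Real.log_le_sub_one_of_pos (by linarith : 0 < x)]
  have h1 : M / (δ / (2 * boostRounds n)) = M / δ * (2 * boostRounds n) := by
    rw [div_div_eq_mul_div, div_mul_eq_mul_div]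
  have hMx : M / δ ≤ x := by rw [hx]; gcongr
  have hMδ : 0 < M / δ := by positivity
  have h2 : M / (δ / (2 * boostRounds n)) ≤ x ^ 3 := by
    rw [h1]
    calc M / δ * (2 * boostRounds n) ≤ x * (2 * (15 * x)) := by
          gcongr
          linarith
      _ = 30 * (x * x) := by ring
      _ ≤ x * (x * x) := by
          gcongr
          linarith
      _ = x ^ 3 := by ring
  have h3 : 1 ≤ x ^ 3 := one_le_pow₀ (by linarith)
  -- The fourth power gives `4 * 40000 = 160000`; the extra `1` in the bound absorbs the ceiling.
  have h4 : 2 + M / (δ / (2 * boostRounds n)) ≤ x ^ 4 := by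
    have : x ^ 4 = x * x ^ 3 := by ring
    nlinarith
  have h5 : 0 ≤ M / (δ / (2 * boostRounds n)) := by positivity
  have h6 : Real.log (2 + M / (δ / (2 * boostRounds n))) ≤ 4 * Real.log x := by
    refine (Real.log_le_log (by linarith) h4).trans ?_
    rw [Real.log_pow]
    norm_num
  have h7 : 0 ≤ Real.log (2 + M / (δ / (2 * boostRounds n))) := Real.log_nonneg (by linarith)
  refine (Nat.ceil_lt_add_one (by positivity)).le.trans ?_
  have h8 : 1 ≤ M * Real.log x := by nlinarith
  have h9 : M * Real.log (2 + M / (δ / (2 * boostRounds n))) ≤ M * (4 * Real.log x) := by gcongr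
  linarith

/-- All exponents are compared with `M Λ³`: index choices and the lost `ε T r` cost at most
`2400015` each, vote sets `240`, and `log (2/δ)` one. The sum is below `5000000`, hence at most `ε
n`. -/
theorem card_mul_exp_le {T r n : ℕ} {M δ ε : ℝ} (hM : 1 ≤ M) (hδ : 0 < δ) (hδ1 : δ < 1)
    (hε : 0 < ε) (hε1 : ε < 1) (hn : 3 ≤ n) (hT : (T : ℝ) ≤ 15 * Real.log (n / δ))
    (hr : (r : ℝ) ≤ 160001 * M * Real.log (n / δ))
    (hsize : 5000000 * (M / ε) * Real.log (n / δ) ^ 3 ≤ n) :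
    ((n ^ (T * r) * (2 ^ T + 1) ^ T : ℕ) : ℝ) * (1 - ε) ^ (n - T * r) ≤ δ / 2 := by
  have hn' : (3 : ℝ) ≤ n := by exact_mod_cast hn
  have hnx : (n : ℝ) ≤ n / δ := le_div_self (by linarith) hδ hδ1.le
  have hlogn : Real.log n ≤ Real.log (n / δ) := Real.log_le_log (by linarith) hnx
  have hlogn0 : 0 ≤ Real.log (n : ℝ) := Real.log_nonneg (by linarith)
  have hlogδ : Real.log (2 / δ) ≤ Real.log (n / δ) :=
    Real.log_le_log (by positivity) (by gcongr; linarith)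
  have hΛ1 : 1 ≤ Real.log (n / δ) := by
    rw [Real.le_log_iff_exp_le (by linarith)]
    linarith [Real.exp_one_lt_d9]
  set Λ := Real.log (n / δ)
  have hsize' : 5000000 * (M * Λ ^ 3) ≤ ε * n := by
    have h1 : 5000000 * (M / ε) * Λ ^ 3 = 5000000 * (M * Λ ^ 3) / ε := by ring
    rw [h1, div_le_iff₀ hε] at hsize
    linarith
  have h2 : Λ ≤ Λ ^ 2 := le_self_pow₀ hΛ1 (by norm_num)
  have h3 : Λ ^ 2 ≤ Λ ^ 3 := pow_le_pow_right₀ hΛ1 (by norm_num)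
  have h4 : Λ ^ 3 ≤ M * Λ ^ 3 := le_mul_of_one_le_left (by positivity) hM
  have h5 : M * Λ ^ 2 ≤ M * Λ ^ 3 := by gcongr
  have hTr : (T : ℝ) * r ≤ 2400015 * (M * Λ ^ 2) := by
    calc (T : ℝ) * r ≤ 15 * Λ * (160001 * M * Λ) := by gcongr
      _ = 2400015 * (M * Λ ^ 2) := by ring
  have hTrlog : (T : ℝ) * r * Real.log n ≤ 2400015 * (M * Λ ^ 3) := by
    calc (T : ℝ) * r * Real.log n ≤ 2400015 * (M * Λ ^ 2) * Λ := by gcongr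
      _ = 2400015 * (M * Λ ^ 3) := by ring
  have hTr0 : (0 : ℝ) ≤ (T : ℝ) * r := by positivity
  have hεTr : ε * (T * r) ≤ T * r := mul_le_of_le_one_left hTr0 hε1.le
  have hTT : (T : ℝ) * (T + 1) ≤ 240 * (M * Λ ^ 3) := by
    calc (T : ℝ) * (T + 1) ≤ 15 * Λ * (15 * Λ + Λ) := by gcongr
      _ = 240 * Λ ^ 2 := by ring
      _ ≤ 240 * (M * Λ ^ 3) := by linarith
  have hle : T * r ≤ n := by
    have h6 : ε * n ≤ n := mul_le_of_le_one_left (by linarith) hε1.le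
    have h7 : (T : ℝ) * r ≤ n := by
      have : 0 ≤ M * Λ ^ 3 := by positivity
      linarith
    exact_mod_cast h7
  have e1 : ((n : ℝ)) ^ (T * r) = Real.exp (T * r * Real.log n) := by
    rw [← Nat.cast_mul, Real.exp_nat_mul, Real.exp_log (by linarith)]
  have e2 : ((2 : ℝ) ^ T + 1) ^ T ≤ Real.exp (T * (T + 1)) := by
    have h6 : (2 : ℝ) ^ T + 1 ≤ Real.exp (T + 1) := by
      have h7 : (2 : ℝ) ≤ Real.exp 1 := by linarith [Real.exp_one_gt_d9]
      calc (2 : ℝ) ^ T + 1 ≤ 2 ^ T + 2 ^ T := by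
            gcongr
            exact one_le_pow₀ (by norm_num)
        _ = 2 ^ (T + 1) := by ring
        _ ≤ Real.exp 1 ^ (T + 1) := by gcongr
        _ = Real.exp (T + 1) := by
            rw [← Real.exp_nat_mul]
            push_cast
            ring_nf
    rw [Real.exp_nat_mul]
    gcongr
  have e3 : (1 - ε) ^ (n - T * r) ≤ Real.exp (-(ε * n) + ε * (T * r)) := by
    calc (1 - ε) ^ (n - T * r) ≤ Real.exp (-ε) ^ (n - T * r) := by
          refine pow_le_pow_left₀ (by linarith) ?_ _
          linarith [Real.add_one_le_exp (-ε)]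
      _ = _ := by
          rw [← Real.exp_nat_mul, Nat.cast_sub hle]
          push_cast
          ring_nf
  have e4 : δ / 2 = Real.exp (-Real.log (2 / δ)) := by
    rw [← Real.log_inv, inv_div, Real.exp_log (by positivity)]
  have hpow0 : 0 ≤ (1 - ε) ^ (n - T * r) := pow_nonneg (by linarith) _
  push_cast
  rw [e1, e4]
  calc _ ≤ Real.exp (T * r * Real.log n) * Real.exp (T * (T + 1)) *
        Real.exp (-(ε * n) + ε * (T * r)) := by gcongr
    _ = Real.exp (T * r * Real.log n + T * (T + 1) + (-(ε * n) + ε * (T * r))) := by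
        rw [← Real.exp_add, ← Real.exp_add]
    _ ≤ _ := by
        apply Real.exp_le_exp.2
        linarith

theorem boostRule_learns {δ : ℝ} (hδ : 0 < δ) (hδ1 : δ < 1) {d k : ℕ} {B : ℝ} (hB : 1 ≤ B)
    {ε : ℝ} (hε : 0 < ε) (hε1 : ε < 1) {n : ℕ}
    (hn : 10 ^ 20 * (capacity d k B / ε) * Real.log (2 + capacity d k B / (ε * δ)) ^ 3 ≤ (n : ℝ)) :
    boostRounds n ≤ n ∧ boostDraws δ d k B n ≤ n ∧
      ∀ (G : GreedyRule d k B) (D : PMF (LabelledExample d)),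
        IsRealizable k B D → InUnitBall D →
          ENNReal.ofReal (1 - δ) ≤
            ((iidSample D n).bind fun S =>
              boostRule G (boostRounds n) (boostDraws δ d k B n) S).toOuterMeasure
              {h | rampLoss D (fun x => labelVal (h x)) ≤ ε} := by
  have hM1 := one_le_capacity d k hB
  have hA1 : 1 ≤ capacity d k B / ε := by
    rw [one_le_div hε]
    linarith
  rw [← div_div] at hn
  have hsize := log_pow_three_mul_le hA1 hδ hδ1 hn
  have hL := one_le_log_two_add (hA1.trans (le_div_self (by linarith) hδ hδ1.le))
  have hn30 : (30 : ℝ) ≤ n := by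
    refine le_trans ?_ hn
    have := one_le_mul_of_one_le_of_one_le hA1 (one_le_pow₀ hL (n := 3))
    linarith
  have hn30' : 30 ≤ n := by exact_mod_cast hn30
  have hnx : (n : ℝ) ≤ n / δ := le_div_self (by linarith) hδ hδ1.le
  have hΛ1 : 1 ≤ Real.log (n / δ) := by
    rw [Real.le_log_iff_exp_le (by linarith)]
    linarith [Real.exp_one_lt_d9]
  have hMA : capacity d k B ≤ capacity d k B / ε := le_div_self (by linarith) hε hε1.le
  have h1 : Real.log (n / δ) ≤ Real.log (n / δ) ^ 3 := le_self_pow₀ hΛ1 (by norm_num)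
  have h2 : capacity d k B * Real.log (n / δ) ≤
      capacity d k B / ε * Real.log (n / δ) ^ 3 := by gcongr
  have h3 : Real.log (n / δ) ≤ capacity d k B * Real.log (n / δ) :=
    le_mul_of_one_le_left (by linarith) hM1
  have h4 : capacity d k B ≤ capacity d k B * Real.log (n / δ) :=
    le_mul_of_one_le_right (by linarith) hΛ1
  have hT := boostRounds_le hδ hδ1 (by lia : 3 ≤ n)
  have hr := boostDraws_le (d := d) (k := k) hB hδ hδ1 hn30' (by linarith)
  refine ⟨?_, ?_, fun G D hD hball => ?_⟩
  · have : (boostRounds n : ℝ) ≤ n := by linarith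
    exact_mod_cast this
  · have : (boostDraws δ d k B n : ℝ) ≤ n := by linarith
    exact_mod_cast this
  · refine ofReal_one_sub_le_toOuterMeasure _ hδ.le ?_
    have hset : {h : Classifier d | rampLoss D (fun x => labelVal (h x)) ≤ ε}ᶜ =
        {h | ε < err D h} := by
      ext h
      simp [rampLoss_labelVal]
    have hTpos : (1 : ℝ) ≤ boostRounds n := by
      have : 1 ≤ boostRounds n := by
        rw [boostRounds]
        lia
      exact_mod_cast this
    have hη : 0 < δ / (2 * boostRounds n) := by positivity
    have hη1 : δ / (2 * boostRounds n) ≤ 1 := by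
      rw [div_le_one (by positivity)]
      linarith
    rw [hset]
    refine (boostRule_failure_le G hB hD hball hη hη1 (Nat.le_ceil _) (by lia)
      (boostRounds_pow_lt n) hε.le).trans ?_
    have hkey := card_mul_exp_le hM1 hδ hδ1 hε hε1 (by lia : 3 ≤ n) hT hr hsize
    rw [← ENNReal.ofReal_natCast, ← ENNReal.ofReal_pow (by linarith),
      ← ENNReal.ofReal_mul (Nat.cast_nonneg _), ← ENNReal.ofReal_natCast (boostRounds n),
      ← ENNReal.ofReal_mul (Nat.cast_nonneg _), ← ENNReal.ofReal_add
        (mul_nonneg (Nat.cast_nonneg _) (pow_nonneg (by linarith) _)) (by positivity)]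
    apply ENNReal.ofReal_le_ofReal
    -- Half of `δ` is spent on the weak learner over all rounds, the other half on generalization.
    have h5 : (boostRounds n : ℝ) * (δ / (2 * boostRounds n)) = δ / 2 := by
      field_simp
    rw [h5]
    refine (add_le_add hkey le_rfl).trans ?_
    linarith

end parameters

end RulesFirst

/-! ### Both claims with common constants -/

open RulesFirst
theorem mainTheorem4 :
    ∃ (C : ℝ) (c : ℕ), 0 < C ∧
      -- BoostRule learns with the claimed sample complexity
      (∀ δ : ℝ, 0 < δ → δ < 1 →
        -- the number of rounds and of examples per call of GreedyRule, from `d`, `k`, `B`, `n`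
        ∃ T r : ℕ → ℕ → ℝ → ℕ → ℕ,
          ∀ (d k : ℕ) (B : ℝ), 1 ≤ B → ∀ ε : ℝ, 0 < ε → ε < 1 → ∀ n : ℕ,
            C * (capacity d k B / ε) * Real.log (2 + capacity d k B / (ε * δ)) ^ c ≤ (n : ℝ) →
              T d k B n ≤ n ∧ r d k B n ≤ n ∧
              ∀ (G : GreedyRule d k B) (D : PMF (LabelledExample d)),
                IsRealizable k B D → InUnitBall D →
                  ENNReal.ofReal (1 - δ) ≤
                    ((iidSample D n).bind fun S =>
                      boostRule G (T d k B n) (r d k B n) S).toOuterMeasure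
                      {h | rampLoss D (fun x => labelVal (h x)) ≤ ε}) ∧
      -- GreedyRule is a weak learner
      (∀ δ : ℝ, 0 < δ → δ < 1 →
        ∀ (d k : ℕ) (B : ℝ), 1 ≤ B → ∀ m : ℕ,
          C * capacity d k B * Real.log (2 + capacity d k B / δ) ^ c ≤ (m : ℝ) →
            ∀ (G : GreedyRule d k B) (D : PMF (LabelledExample d)),
              IsRealizable k B D → InUnitBall D →
                ENNReal.ofReal (1 - δ) ≤
                  (iidSample D m).toOuterMeasure {S | err D (G.hyp S) ≤ 1 / 4}) := by
  refine ⟨10 ^ 20, 3, by norm_num, fun δ hδ hδ1 => ⟨fun _ _ _ n => boostRounds n, boostDraws δ,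
    fun d k B hB ε hε hε1 n hn => boostRule_learns hδ hδ1 hB hε hε1 hn⟩,
    fun δ hδ hδ1 d k B hB m hm G D hD hball => ?_⟩
  refine ofReal_one_sub_le_toOuterMeasure _ hδ.le ?_
  have hset : {S : Fin m → LabelledExample d | err D (G.hyp S) ≤ 1 / 4}ᶜ =
      {S | 1 / 4 < err D (G.hyp S)} := by
    ext S
    simp
  rw [hset]
  refine greedyRule_weak G hB hD hball hδ hδ1.le (le_trans ?_ hm)
  have hM1 := one_le_capacity d k hB
  have hL := one_le_log_two_add (hM1.trans (le_div_self (by linarith) hδ hδ1.le))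
  have h1 : Real.log (2 + capacity d k B / δ) ≤ Real.log (2 + capacity d k B / δ) ^ 3 :=
    le_self_pow₀ hL (by norm_num)
  gcongr
  norm_num
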